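/- Let $X=[x^{\rm low}_1,x^{\rm high}_1]\times[x^{\rm low}_2,x^{\rm high}_2]$ with $x^{\rm low}_1,x^{\rm low}_2\ge 0$, and let $f$ be a probability density on $X$ that is continuous and differentiable with bounded derivatives. A mechanism consists of an allocation function $\mathcal P:X\to[0,1]^2$ and a price function $\mathcal T:X\to\mathbb R$; its utility function is $u(x)=x\cdot\mathcal P(x)-\mathcal T(x)$. It is incentive compatible (IC) if $u(x)\ge x\cdot\mathcal P(x')-\mathcal T(x')$ for all $x,x'\in X$, and individually rational (IR) if $u\ge 0$. An IC and IR mechanism is optimal if it maximizes the expected revenue $\int_X\mathcal T f\,dx$ among all IC and IR mechanisms. The transformed measure $\mu$ of $f$ is the signed measure $$\mu(S)=\int_{\partial X}\mathbb 1_S(x)f(x)(x\cdot\hat n)\,dx-\int_X\mathbb 1_S(x)\,(\nabla f(x)\cdot x+3f(x))\,dx+\mathbb 1_S(x^{\rm low}),$$ where $\hat n$ is the outer unit normal. An exclusion set is a convex, compact subset $Z\subseteq X$ with nonempty interior that is decreasing (if $a\le b$ componentwise, $a\in X$ and $b\in Z$, then $a\in Z$). Put $u_Z(x)=\min_{z\in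 Z}\|z-x\|_1$, $P=\max\{x+y:(x,y)\in Z\}$, $x_{\rm crit}=\min\{x:(x,P-x)\in Z\}$, $y_{\rm crit}=\min\{y:(P-y,y)\in Z\}$, $s_1(x)=\max\{y:(x,y)\in Z\}$ for $x\in[x^{\rm low}_1,x_{\rm crit}]$ and $s_2(y)=\max\{x:(x,y)\in Z\}$ for $y\in[x^{\rm low}_2,y_{\rm crit}]$. The canonical partition of $X$ induced by $Z$ is $X=Z\cup\mathcal A\cup\mathcal B\cup\mathcal W$ with $\mathcal A=\{(x,y)\in X:x<x_{\rm crit}\}\setminus Z$, $\mathcal B=\{(x,y)\in X:y<y_{\rm crit}\}\setminus Z$ and $\mathcal W=X\setminus(Z\cup\mathcal A\cup\mathcal B)$. It is well-formed with respect to $\mu$ if 1. $\mu|_Z\preceq_{cvx}0$, i.e. $\int_Z u\,d\mu\le 0$ for every continuous, non-decreasing, convex $u:X\to\mathbb R$; and $\mu|_{\mathcal W}\succeq_2 0$, i.e. $\int_{\mathcal W}u\,d\mu\le 0$ for every continuous, non-increasing, convex $u:X\to\mathbb R$; 2. for all $v\in X$ and $\epsilon>0$: $\mu|_{\mathcal A}([v_1,v_1+\epsilon]\times[v_2,\infty))\ge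 0$, with equality whenever $v_2=x^{\rm low}_2$, and $\mu|_{\mathcal B}([v_1,\infty)\times[v_2,v_2+\epsilon])\ge 0$, with equality whenever $v_1=x^{\rm low}_1$. Theorem. If $Z$ is an exclusion set whose canonical partition is well-formed with respect to the transformed measure $\mu$ of $f$, then the mechanism induced by $Z$ is optimal: every IC mechanism whose utility function is $u_Z$ is an optimal IC and IR mechanism for $f$, and such a mechanism exists. The mechanism uses the following allocation and price for the reported type $(x,y)\in X$: - if $(x,y)\in Z$, the buyer receives no goods and is charged $0$; - if $(x,y)\in\mathcal A$, the buyer receives item $1$ with probability $-s_1'(x)$, item $2$ with probability $1$, and is charged $s_1(x)-x\,s_1'(x)$; - if $(x,y)\in\mathcal B$, the buyer receives item $2$ with probability $-s_2'(y)$, item $1$ with probability $1$, and is charged $s_2(y)-y\,s_2'(y)$; - if $(x,y)\in\mathcal W$, the buyer receives both goods with probability $1$ and is charged $P$. Precisely: there is an optimal mechanism with utility function $u_Z$ that uses these outcomes at every type, where $s_1',s_2'$ denote right derivatives (these exist, and equal the derivatives wherever the latter exist); and every IC mechanism with utility function $u_Z$ uses these outcomes at almost every type of $X$, where for almost every type in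 $\mathcal A$ (respectively $\mathcal B$) the derivative $s_1'(x)$ (respectively $s_2'(y)$) exists. -/

import Mathlib

open MeasureTheory Set

namespace TwoGoods

noncomputable section

/-! Types are points `p = (p.1, p.2)` of the plane; the type space is the box
`Icc lo hi = [lo.1, hi.1] × [lo.2, hi.2]` (the order on `ℝ × ℝ` is componentwise). -/

/-- The `ℓ₁` distance on the plane. -/
def l1dist (p q : ℝ × ℝ) : ℝ := |p.1 - q.1| + |p.2 - q.2|

/-! ### Mechanisms -/

/-- A direct mechanism over the type space `X`: allocation probabilities of the two goods, which
lie in `[0,1]²`, and a price, for every reported type.  Only the values on `X` matter. -/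
structure Mechanism (X : Set (ℝ × ℝ)) where
  /-- the allocation function -/
  alloc : ℝ × ℝ → ℝ × ℝ
  /-- the price function -/
  price : ℝ × ℝ → ℝ
  /-- allocation probabilities lie in `[0,1]` -/
  alloc_mem : ∀ p ∈ X, alloc p ∈ Icc (0 : ℝ × ℝ) 1

namespace Mechanism

variable {X : Set (ℝ × ℝ)}

/-- The utility of an additive buyer of type `p` who declares the type `q`. -/
def payoff (M : Mechanism X) (p q : ℝ × ℝ) : ℝ :=
  p.1 * (M.alloc q).1 + p.2 * (M.alloc q).2 - M.price q

/-- The utility of a truthful buyer. -/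
def utility (M : Mechanism X) (p : ℝ × ℝ) : ℝ := M.payoff p p

/-- Incentive compatibility. -/
def IsIC (M : Mechanism X) : Prop := ∀ p ∈ X, ∀ q ∈ X, M.payoff p q ≤ M.payoff p p

/-- Individual rationality. -/
def IsIR (M : Mechanism X) : Prop := ∀ p ∈ X, 0 ≤ M.utility p

/-- The expected revenue when types have density `f` on `X`. -/
def revenue (M : Mechanism X) (f : ℝ × ℝ → ℝ) : ℝ := ∫ p in X, M.price p * f p

/-- `M` is an optimal IC and IR mechanism for the density `f`: it is IC and IR, and no IC and IR
mechanism has a larger expected revenue, all these expected revenues being genuine integrals. -/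
def IsOptimal (M : Mechanism X) (f : ℝ × ℝ → ℝ) : Prop :=
  M.IsIC ∧ M.IsIR ∧ IntegrableOn (fun p => M.price p * f p) X ∧
    ∀ M' : Mechanism X, M'.IsIC → M'.IsIR →
      IntegrableOn (fun p => M'.price p * f p) X ∧ M'.revenue f ≤ M.revenue f

end Mechanism

/-! ### Type densities and the transformed measure -/

/-- `f` is a probability density on the box, continuous, and differentiable with bounded
derivatives (differentiability is asked in the interior of the box). -/
structure IsTypeDensity (lo hi : ℝ × ℝ) (f : ℝ × ℝ → ℝ) : Prop where
  nonneg : ∀ p ∈ Icc lo hi, 0 ≤ f p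
  integral_eq_one : ∫ p in Icc lo hi, f p = 1
  continuousOn : ContinuousOn f (Icc lo hi)
  differentiableAt : ∀ p ∈ interior (Icc lo hi), DifferentiableAt ℝ f p
  bounded_deriv : ∃ C : ℝ, ∀ p ∈ interior (Icc lo hi), ‖fderiv ℝ f p‖ ≤ C

/-- The transformed measure of the density `f` on the box, that is
`μ(S) = ∫_{∂X} 1_S(p) f(p) (p · n̂(p)) dp - ∫_X 1_S(p) (∇f(p) · p + 3 f(p)) dp + 1_S(lo)`.
The first four terms are the right, left, top and bottom edges, with outer unit normals
`(1,0)`, `(-1,0)`, `(0,1)`, `(0,-1)`; note `fderiv ℝ f p p = ∇f(p) · p`. -/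
def transformedMeasure (lo hi : ℝ × ℝ) (f : ℝ × ℝ → ℝ) : SignedMeasure (ℝ × ℝ) :=
  ((volume.restrict (Icc lo.2 hi.2)).withDensityᵥ (fun y => hi.1 * f (hi.1, y))).map
      (fun y => (hi.1, y))
    - ((volume.restrict (Icc lo.2 hi.2)).withDensityᵥ (fun y => lo.1 * f (lo.1, y))).map
      (fun y => (lo.1, y))
    + ((volume.restrict (Icc lo.1 hi.1)).withDensityᵥ (fun x => hi.2 * f (x, hi.2))).map
      (fun x => (x, hi.2))
    - ((volume.restrict (Icc lo.1 hi.1)).withDensityᵥ (fun x => lo.2 * f (x, lo.2))).map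
      (fun x => (x, lo.2))
    - (volume.restrict (Icc lo hi)).withDensityᵥ (fun p => fderiv ℝ f p p + 3 * f p)
    + VectorMeasure.dirac lo 1

/-! ### Stochastic dominance of signed measures on a box `X` -/

/-- `α ⪰_cvx β`: every continuous, non-decreasing, convex function on `X` has at least as large an
integral with respect to `α` as with respect to `β`. -/
def ConvexlyDominates (X : Set (ℝ × ℝ)) (α β : SignedMeasure (ℝ × ℝ)) : Prop :=
  ∀ u : ℝ × ℝ → ℝ, ContinuousOn u X → MonotoneOn u X → ConvexOn ℝ X u →
    ∫ᵛ p, u p ∂<•β ≤ ∫ᵛ p, u p ∂<•α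

/-- `α ⪰₂ β` (second-order dominance): every continuous, non-increasing, convex function on `X` has
at most as large an integral with respect to `α` as with respect to `β`. -/
def SecondOrderDominates (X : Set (ℝ × ℝ)) (α β : SignedMeasure (ℝ × ℝ)) : Prop :=
  ∀ u : ℝ × ℝ → ℝ, ContinuousOn u X → AntitoneOn u X → ConvexOn ℝ X u →
    ∫ᵛ p, u p ∂<•α ≤ ∫ᵛ p, u p ∂<•β

/-! ### Exclusion sets and canonical partitions -/

/-- An exclusion set: a convex, compact, decreasing subset of the box with nonempty interior. -/
structure IsExclusionSet (lo hi : ℝ × ℝ) (Z : Set (ℝ × ℝ)) : Prop where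
  subset : Z ⊆ Icc lo hi
  convex : Convex ℝ Z
  isCompact : IsCompact Z
  decreasing : ∀ a ∈ Icc lo hi, ∀ b ∈ Z, a ≤ b → a ∈ Z
  nonempty_interior : (interior Z).Nonempty

/-- `u_Z(p) = min_{z ∈ Z} ‖z - p‖₁`. -/
def exclusionUtility (Z : Set (ℝ × ℝ)) (p : ℝ × ℝ) : ℝ := sInf ((fun z => l1dist z p) '' Z)

/-- The critical price `max {x + y : (x, y) ∈ Z}`. -/
def criticalPrice (Z : Set (ℝ × ℝ)) : ℝ := sSup ((fun z => z.1 + z.2) '' Z)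

/-- `x_crit = min {x : (x, P - x) ∈ Z}`, with `P` the critical price. -/
def xCrit (Z : Set (ℝ × ℝ)) : ℝ := sInf {x | (x, criticalPrice Z - x) ∈ Z}

/-- `y_crit = min {y : (P - y, y) ∈ Z}`, with `P` the critical price. -/
def yCrit (Z : Set (ℝ × ℝ)) : ℝ := sInf {y | (criticalPrice Z - y, y) ∈ Z}

/-- The outer boundary function `s₁(x) = max {y : (x, y) ∈ Z}`, used on `[lo.1, x_crit]`. -/
def outerBoundary₁ (Z : Set (ℝ × ℝ)) (x : ℝ) : ℝ := sSup {y | (x, y) ∈ Z}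

/-- The outer boundary function `s₂(y) = max {x : (x, y) ∈ Z}`, used on `[lo.2, y_crit]`. -/
def outerBoundary₂ (Z : Set (ℝ × ℝ)) (y : ℝ) : ℝ := sSup {x | (x, y) ∈ Z}

/-- The region `𝒜` of the canonical partition of the type space `X` induced by `Z`. -/
def regionA (X Z : Set (ℝ × ℝ)) : Set (ℝ × ℝ) := {p ∈ X | p.1 < xCrit Z} \ Z

/-- The region `ℬ` of the canonical partition. -/
def regionB (X Z : Set (ℝ × ℝ)) : Set (ℝ × ℝ) := {p ∈ X | p.2 < yCrit Z} \ Z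

/-- The region `𝒲` of the canonical partition. -/
def regionW (X Z : Set (ℝ × ℝ)) : Set (ℝ × ℝ) := X \ (Z ∪ regionA X Z ∪ regionB X Z)

/-- The canonical partition induced by `Z` is well-formed with respect to the signed measure `μ`
on the box.  That `μ` has total mass zero needs no clause of its own: the conditions below force
each of the four regions to have mass zero. -/
structure WellFormed (lo hi : ℝ × ℝ) (Z : Set (ℝ × ℝ)) (μ : SignedMeasure (ℝ × ℝ)) : Prop where
  dom_Z : ConvexlyDominates (Icc lo hi) 0 (μ.restrict Z)
  dom_W : SecondOrderDominates (Icc lo hi) (μ.restrict (regionW (Icc lo hi) Z)) 0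
  strip_A : ∀ v ∈ Icc lo hi, ∀ ε : ℝ, 0 < ε →
    0 ≤ μ.restrict (regionA (Icc lo hi) Z) (Icc v.1 (v.1 + ε) ×ˢ Ici v.2) ∧
    (v.2 = lo.2 → μ.restrict (regionA (Icc lo hi) Z) (Icc v.1 (v.1 + ε) ×ˢ Ici v.2) = 0)
  strip_B : ∀ v ∈ Icc lo hi, ∀ ε : ℝ, 0 < ε →
    0 ≤ μ.restrict (regionB (Icc lo hi) Z) (Ici v.1 ×ˢ Icc v.2 (v.2 + ε)) ∧
    (v.1 = lo.1 → μ.restrict (regionB (Icc lo hi) Z) (Ici v.1 ×ˢ Icc v.2 (v.2 + ε)) = 0)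

/-- At the reported type `p`, the mechanism `M` uses the allocation and price read off from the
canonical partition, `d₁` and `d₂` playing the role of the derivatives of the outer boundary
functions `s₁` and `s₂`. -/
structure HasCanonicalOutcome {X : Set (ℝ × ℝ)} (M : Mechanism X) (Z : Set (ℝ × ℝ))
    (d₁ d₂ : ℝ → ℝ) (p : ℝ × ℝ) : Prop where
  on_Z : p ∈ Z → M.alloc p = (0, 0) ∧ M.price p = 0
  on_A : p ∈ regionA X Z →
    M.alloc p = (-d₁ p.1, 1) ∧ M.price p = outerBoundary₁ Z p.1 - p.1 * d₁ p.1
  on_B : p ∈ regionB X Z →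
    M.alloc p = (1, -d₂ p.2) ∧ M.price p = outerBoundary₂ Z p.2 - p.2 * d₂ p.2
  on_W : p ∈ regionW X Z → M.alloc p = (1, 1) ∧ M.price p = criticalPrice Z

end

end TwoGoods

open TwoGoods

namespace TwoGoods

open Filter Topology ENNReal

/-! ### Integration against signed measures -/

/-! By incentive compatibility, a utility function `u` is convex, with the allocation as a
subgradient. Since allocations lie in `[0,1]²`, `u` is also non-decreasing and grows by at most the
`ℓ₁` distance between ordered types. Almost everywhere the allocation is `∇u`, so revenue is the
integral of `(∇u · p - u) f`. Integrating by parts moves the derivative onto `f` and gives `∫ u dμ -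
u(lo)` (`revenue_eq`). As `u_Z(lo) = 0` and individual rationality forces `u(lo) ≥ 0`, it remains to
show `∫ v dμ ≤ ∫ u_Z dμ` for every competing utility `v`.

This is proved on each region separately (`integral_le_integral_exclusionUtility`), using the
explicit form of `u_Z`. On `Z` it is `0`, and convex dominance bounds `∫ v`. On `𝒲` it is `x + y -
P`, so `v - u_Z` is there a convex function whose increments are at most zero, and second-order
dominance applies. On `𝒜` it is `y - s₁(x)`, so `u_Z - v` is non-decreasing in `y` along each
vertical line. The strip conditions say that `μ` moves mass upwards inside vertical strips, so such
a function has a nonnegative integral (`integral_nonneg_of_strips`). The region `ℬ` is the mirror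
image.

The canonical mechanism exists because each of its menu entries is an affine function lying below
`u_Z` and touching it at the types that choose it (`exists_canonicalMechanism`). The utility
determines the allocation, hence the price, almost everywhere, so any other IC mechanism with
utility `u_Z` agrees with the canonical one almost everywhere. -/

theorem isFiniteMeasure_variation {α : Type*} [MeasurableSpace α] (ν : SignedMeasure α) :
    IsFiniteMeasure ν.variation :=
  ν.totalVariation_eq_variation ▸ inferInstance

theorem integrable_of_continuousOn {X : Set (ℝ × ℝ)} (hX : IsCompact X)
    {ν : SignedMeasure (ℝ × ℝ)} (hν : ν.variation Xᶜ = 0) {g : ℝ × ℝ → ℝ}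
    (hg : ContinuousOn g X) : ν.Integrable g := by
  have := isFiniteMeasure_variation ν
  have h := hg.integrableOn_compact (μ := ν.variation) hX
  rwa [IntegrableOn, Measure.restrict_eq_self_of_ae_mem] at h
  exact hν

theorem integrable_of_bounded {ν : SignedMeasure (ℝ × ℝ)} {g : ℝ × ℝ → ℝ} (hg : Continuous g)
    {C : ℝ} (hC : ∀ p, ‖g p‖ ≤ C) : ν.Integrable g := by
  have := isFiniteMeasure_variation ν
  exact Integrable.of_bound hg.aestronglyMeasurable C (Eventually.of_forall hC)

/-- The integral against a signed measure through its Jordan decomposition. -/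
theorem integral_eq_posPart_sub_negPart {α : Type*} [MeasurableSpace α] (ν : SignedMeasure α)
    {g : α → ℝ} (hg : ν.Integrable g) :
    ∫ᵛ p, g p ∂<•ν = ∫ p, g p ∂ν.toJordanDecomposition.posPart
      - ∫ p, g p ∂ν.toJordanDecomposition.negPart := by
  have h : Integrable g (ν.toJordanDecomposition.posPart + ν.toJordanDecomposition.negPart) := by
    have h' : Integrable g ν.variation := hg
    rwa [← ν.totalVariation_eq_variation] at h'
  rw [integrable_add_measure] at h
  conv_lhs => rw [← ν.toSignedMeasure_toJordanDecomposition]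
  rw [JordanDecomposition.toSignedMeasure, VectorMeasure.integral_sub_vectorMeasure,
    VectorMeasure.integral_toSignedMeasure, VectorMeasure.integral_toSignedMeasure]
  · simpa [VectorMeasure.Integrable] using h.1
  · simpa [VectorMeasure.Integrable] using h.2

/-! ### Comparison of measures that are ordered on vertical strips -/

theorem exists_eq_Ici_of_isUpperSet {s : Set ℝ} (hs : IsClosed s) (hu : IsUpperSet s) :
    s = ∅ ∨ s = univ ∨ ∃ c, s = Ici c := by
  rcases s.eq_empty_or_nonempty with h | h
  · exact Or.inl h
  by_cases hb : BddBelow s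
  · refine Or.inr (Or.inr ⟨sInf s, ?_⟩)
    exact Subset.antisymm (fun x hx => csInf_le hb hx) (fun x hx => hu hx (hs.csInf_mem h hb))
  · refine Or.inr (Or.inl (eq_univ_of_forall fun x => ?_))
    rw [not_bddBelow_iff] at hb
    obtain ⟨y, hy, hyx⟩ := hb x
    exact hu hyx.le hy

/-- Comparison of integrals of a function that is a step function of the first coordinate and
non-decreasing in the second one. -/
theorem lintegral_le_of_strips {α β : Measure (ℝ × ℝ)}
    (h : ∀ a b c : ℝ, β (Ico a b ×ˢ Ici c) ≤ α (Ico a b ×ˢ Ici c))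
    (h' : ∀ a b : ℝ, β (Ico a b ×ˢ univ) ≤ α (Ico a b ×ˢ univ))
    {ψ : ℝ × ℝ → ℝ} (hc : Continuous ψ) (h0 : ∀ p, 0 ≤ ψ p)
    (hm : ∀ x, Monotone fun y => ψ (x, y)) (n : ℕ) :
    ∫⁻ p, ENNReal.ofReal (ψ (⌊(n + 1 : ℝ) * p.1⌋ / (n + 1 : ℝ), p.2)) ∂β ≤
      ∫⁻ p, ENNReal.ofReal (ψ (⌊(n + 1 : ℝ) * p.1⌋ / (n + 1 : ℝ), p.2)) ∂α := by
  have hmeas : Measurable fun p : ℝ × ℝ => ψ (⌊(n + 1 : ℝ) * p.1⌋ / (n + 1 : ℝ), p.2) := by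
    fun_prop
  have hn : (0 : ℝ) < n + 1 := by positivity
  -- Layer cake: it suffices to compare the measures of superlevel sets. Since the first coordinate
  -- is rounded down to a grid, such a set is a countable disjoint union of strips, each over one
  -- grid cell and closed upwards in the second coordinate.
  rw [lintegral_eq_lintegral_meas_le β (Eventually.of_forall fun p => h0 _) hmeas.aemeasurable,
    lintegral_eq_lintegral_meas_le α (Eventually.of_forall fun p => h0 _) hmeas.aemeasurable]
  refine lintegral_mono fun t => ?_
  have hset : {p : ℝ × ℝ | t ≤ ψ (⌊(n + 1 : ℝ) * p.1⌋ / (n + 1 : ℝ), p.2)} =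
      ⋃ i : ℤ, Ico ((i : ℝ) / (n + 1)) ((i + 1 : ℝ) / (n + 1)) ×ˢ
        {y | t ≤ ψ ((i : ℝ) / (n + 1), y)} := by
    ext p
    simp only [mem_ofPred_eq, mem_iUnion, mem_prod, mem_Ico]
    have key : ∀ i : ℤ, (i : ℝ) / (n + 1) ≤ p.1 ∧ p.1 < (i + 1 : ℝ) / (n + 1) ↔
        ⌊(n + 1 : ℝ) * p.1⌋ = i := by
      intro i
      rw [Int.floor_eq_iff, div_le_iff₀ hn, lt_div_iff₀ hn, mul_comm p.1]
    simp only [key]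
    constructor
    · intro h; exact ⟨_, rfl, h⟩
    · rintro ⟨i, rfl, h⟩; exact h
  have hdisj : Pairwise (Function.onFun Disjoint fun i : ℤ =>
      Ico ((i : ℝ) / (n + 1)) ((i + 1 : ℝ) / (n + 1)) ×ˢ {y | t ≤ ψ ((i : ℝ) / (n + 1), y)}) := by
    intro i j hij
    refine Set.disjoint_left.2 ?_
    rintro p ⟨⟨h1, h2⟩, -⟩ ⟨⟨h3, h4⟩, -⟩
    apply hij
    rw [div_le_iff₀ hn] at h1 h3
    rw [lt_div_iff₀ hn] at h2 h4
    have e1 : (i : ℝ) < j + 1 := h1.trans_lt h4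
    have e2 : (j : ℝ) < i + 1 := h3.trans_lt h2
    norm_cast at e1 e2
    lia
  have hclosed : ∀ i : ℤ, IsClosed {y | t ≤ ψ ((i : ℝ) / (n + 1), y)} := fun i =>
    isClosed_le continuous_const (by fun_prop)
  rw [hset, measure_iUnion hdisj fun i => measurableSet_Ico.prod (hclosed i).measurableSet,
    measure_iUnion hdisj fun i => measurableSet_Ico.prod (hclosed i).measurableSet]
  refine ENNReal.tsum_le_tsum fun i => ?_
  have hup : IsUpperSet {y | t ≤ ψ ((i : ℝ) / (n + 1), y)} := fun y z hyz hy =>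
    le_trans hy (hm _ hyz)
  rcases exists_eq_Ici_of_isUpperSet (hclosed i) hup with h1 | h1 | ⟨c, h1⟩
  · simp [h1]
  · rw [h1]; exact h' _ _
  · rw [h1]; exact h _ _ _

theorem tendsto_floor_mul_div (x : ℝ) :
    Tendsto (fun n : ℕ => (⌊(n + 1 : ℝ) * x⌋ : ℝ) / (n + 1 : ℝ)) atTop (𝓝 x) := by
  have h1 : Tendsto (fun n : ℕ => x - 1 / ((n : ℝ) + 1)) atTop (𝓝 x) := by
    simpa using (tendsto_const_nhds (x := x)).sub
      (tendsto_one_div_add_atTop_nhds_zero_nat (𝕜 := ℝ))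
  refine tendsto_of_tendsto_of_tendsto_of_le_of_le h1 tendsto_const_nhds (fun n => ?_)
    fun n => ?_
  · have hn : (0 : ℝ) < n + 1 := by positivity
    have := (Int.sub_one_lt_floor ((n + 1 : ℝ) * x)).le
    show x - 1 / ((n : ℝ) + 1) ≤ _
    rw [le_div_iff₀ hn, sub_mul, div_mul_cancel₀ _ hn.ne']
    linarith
  · have hn : (0 : ℝ) < n + 1 := by positivity
    have := Int.floor_le ((n + 1 : ℝ) * x)
    show _ ≤ x
    rw [div_le_iff₀ hn]
    linarith

/-- If one finite measure dominates another one on all strips `[a, b) × [c, ∞)`, with equality of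
the total masses, then it also gives a larger integral to every bounded continuous function that is
non-decreasing in the second coordinate. -/
theorem integral_le_of_strips {α β : Measure (ℝ × ℝ)} [IsFiniteMeasure α] [IsFiniteMeasure β]
    (h : ∀ a b c : ℝ, β (Ico a b ×ˢ Ici c) ≤ α (Ico a b ×ˢ Ici c))
    (h' : ∀ a b : ℝ, β (Ico a b ×ˢ univ) ≤ α (Ico a b ×ˢ univ))
    (huniv : α univ = β univ)
    {ψ : ℝ × ℝ → ℝ} (hc : Continuous ψ) {C : ℝ} (hC : ∀ p, ‖ψ p‖ ≤ C)
    (hm : ∀ x, Monotone fun y => ψ (x, y)) : ∫ p, ψ p ∂β ≤ ∫ p, ψ p ∂α := by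
  -- The layer cake formula needs a nonnegative integrand. Adding `C` changes both integrals by the
  -- same amount because the total masses agree; this is the only use of `huniv`.
  set θ : ℝ × ℝ → ℝ := fun p => ψ p + C with hθ
  have hθc : Continuous θ := by fun_prop
  have hb : ∀ p, -C ≤ ψ p ∧ ψ p ≤ C := fun p => abs_le.1 (hC p)
  have hθ0 : ∀ p, 0 ≤ θ p := fun p => by have := (hb p).1; simp only [hθ]; linarith
  have hθb : ∀ p, ‖θ p‖ ≤ 2 * C := fun p => by
    rw [Real.norm_of_nonneg (hθ0 p)]; have := (hb p).2; simp only [hθ]; linarith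
  have hθm : ∀ x, Monotone fun y => θ (x, y) := fun x y z hyz => by
    have := hm x hyz
    simp only [hθ] at *; linarith
  have hmeas : ∀ n : ℕ, Measurable fun p : ℝ × ℝ =>
      θ (⌊(n + 1 : ℝ) * p.1⌋ / (n + 1 : ℝ), p.2) := fun n => by fun_prop
  have hlim : ∀ γ : Measure (ℝ × ℝ), IsFiniteMeasure γ → Tendsto
      (fun n : ℕ => ∫ p, θ (⌊(n + 1 : ℝ) * p.1⌋ / (n + 1 : ℝ), p.2) ∂γ) atTop
      (𝓝 (∫ p, θ p ∂γ)) := by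
    intro γ _
    refine tendsto_integral_of_dominated_convergence (fun _ => 2 * C)
      (fun n => (hmeas n).aestronglyMeasurable) (integrable_const _)
      (fun n => Eventually.of_forall fun p => hθb _) (Eventually.of_forall fun p => ?_)
    exact (hθc.tendsto p).comp ((tendsto_floor_mul_div p.1).prodMk_nhds tendsto_const_nhds)
  have hle : ∫ p, θ p ∂β ≤ ∫ p, θ p ∂α := by
    refine le_of_tendsto_of_tendsto' (hlim β inferInstance) (hlim α inferInstance) fun n => ?_
    rw [integral_eq_lintegral_of_nonneg_ae (Eventually.of_forall fun p => hθ0 _)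
        (hmeas n).aestronglyMeasurable,
      integral_eq_lintegral_of_nonneg_ae (Eventually.of_forall fun p => hθ0 _)
        (hmeas n).aestronglyMeasurable]
    refine ENNReal.toReal_mono ?_ (lintegral_le_of_strips h h' hθc hθ0 hθm n)
    have : Integrable (fun p : ℝ × ℝ => θ (⌊(n + 1 : ℝ) * p.1⌋ / (n + 1 : ℝ), p.2)) α :=
      Integrable.of_bound (hmeas n).aestronglyMeasurable (2 * C)
        (Eventually.of_forall fun p => hθb _)
    exact (hasFiniteIntegral_iff_ofReal (Eventually.of_forall fun p => hθ0 _)).1 this.2 |>.ne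
  have hint : ∀ γ : Measure (ℝ × ℝ), IsFiniteMeasure γ → Integrable ψ γ := fun γ _ =>
    Integrable.of_bound hc.aestronglyMeasurable C (Eventually.of_forall hC)
  simp only [hθ] at hle
  rw [integral_add (hint β inferInstance) (integrable_const _),
    integral_add (hint α inferInstance) (integrable_const _)] at hle
  simp only [integral_const, measureReal_def, huniv] at hle
  linarith

/-! ### Clamping to a box -/

/-- The projection of the plane onto the box `Icc lo hi`. -/
noncomputable def clamp (lo hi p : ℝ × ℝ) : ℝ × ℝ := lo ⊔ (p ⊓ hi)

theorem clamp_mem {lo hi : ℝ × ℝ} (h : lo ≤ hi) (p : ℝ × ℝ) : clamp lo hi p ∈ Icc lo hi :=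
  ⟨le_sup_left, sup_le h inf_le_right⟩

theorem clamp_of_mem {lo hi p : ℝ × ℝ} (hp : p ∈ Icc lo hi) : clamp lo hi p = p := by
  rw [clamp, inf_eq_left.2 hp.2, sup_eq_right.2 hp.1]

theorem lipschitzWith_clamp (lo hi : ℝ × ℝ) : LipschitzWith 1 (clamp lo hi) := by
  have h : ∀ a b : ℝ, LipschitzWith 1 fun x : ℝ => max a (min x b) := fun a b =>
    (LipschitzWith.id.min_const b).const_max a
  refine LipschitzWith.of_dist_le_mul fun p q => ?_
  rw [Prod.dist_eq, Prod.dist_eq]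
  rw [NNReal.coe_one, one_mul]
  refine max_le_max ?_ ?_
  · have := (h lo.1 hi.1).dist_le_mul p.1 q.1
    rwa [NNReal.coe_one, one_mul] at this
  · have := (h lo.2 hi.2).dist_le_mul p.2 q.2
    rwa [NNReal.coe_one, one_mul] at this

theorem continuous_clamp (lo hi : ℝ × ℝ) : Continuous (clamp lo hi) :=
  (lipschitzWith_clamp lo hi).continuous

theorem continuous_comp_clamp {lo hi : ℝ × ℝ} (h : lo ≤ hi) {g : ℝ × ℝ → ℝ}
    (hg : ContinuousOn g (Icc lo hi)) : Continuous fun p => g (clamp lo hi p) :=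
  hg.comp_continuous (continuous_clamp lo hi) (clamp_mem h)

theorem exists_bound_comp_clamp {lo hi : ℝ × ℝ} (h : lo ≤ hi) {g : ℝ × ℝ → ℝ}
    (hg : ContinuousOn g (Icc lo hi)) : ∃ C, ∀ p, ‖g (clamp lo hi p)‖ ≤ C := by
  obtain ⟨C, hC⟩ := isCompact_Icc.exists_bound_of_continuousOn hg
  exact ⟨C, fun p => hC _ (clamp_mem h p)⟩

/-- A measure carried by the box does not see values outside it. Functions continuous only on the
box can thus be replaced by bounded continuous functions on the plane. -/
theorem integral_comp_clamp {lo hi : ℝ × ℝ} {ν : SignedMeasure (ℝ × ℝ)}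
    (hν : ν.variation (Icc lo hi)ᶜ = 0) (g : ℝ × ℝ → ℝ) :
    ∫ᵛ p, g (clamp lo hi p) ∂<•ν = ∫ᵛ p, g p ∂<•ν := by
  refine VectorMeasure.integral_congr_ae ?_
  have : ∀ᵐ p ∂ν.variation, p ∈ Icc lo hi := hν
  filter_upwards [this] with p hp
  rw [clamp_of_mem hp]

/-! ### Signed measures that are nonnegative on strips -/

/-- The strip conditions concern closed intervals of positive width, whereas tiling needs half-open
ones. The shift `n + 2`, rather than `n + 1`, keeps the width positive at `n = 0`. -/
theorem iUnion_Icc_add_eq_Ico {a b : ℝ} (hab : a < b) :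
    ⋃ n : ℕ, Icc a (a + (b - a) * (1 - 1 / ((n : ℝ) + 2))) = Ico a b := by
  ext x
  simp only [mem_iUnion, mem_Icc, mem_Ico]
  constructor
  · rintro ⟨n, h1, h2⟩
    refine ⟨h1, h2.trans_lt ?_⟩
    have : 0 < (b - a) * (1 / ((n : ℝ) + 2)) := mul_pos (sub_pos.2 hab) (by positivity)
    linarith
  · rintro ⟨h1, h2⟩
    obtain ⟨n, hn⟩ := exists_nat_one_div_lt (div_pos (sub_pos.2 h2) (sub_pos.2 hab))
    refine ⟨n, h1, ?_⟩
    rw [lt_div_iff₀ (sub_pos.2 hab)] at hn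
    have : 1 / ((n : ℝ) + 2) * (b - a) ≤ 1 / ((n : ℝ) + 1) * (b - a) := by
      refine mul_le_mul_of_nonneg_right ?_ (sub_pos.2 hab).le
      exact one_div_le_one_div_of_le (by positivity) (by linarith)
    linarith

theorem tendsto_measure_strip (α : Measure (ℝ × ℝ)) {a b : ℝ} (hab : a < b) (c : ℝ) :
    Tendsto (fun n : ℕ => α (Icc a (a + (b - a) * (1 - 1 / ((n : ℝ) + 2))) ×ˢ Ici c)) atTop
      (𝓝 (α (Ico a b ×ˢ Ici c))) := by
  rw [← iUnion_Icc_add_eq_Ico hab, iUnion_prod_const]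
  refine tendsto_measure_iUnion_atTop fun m n hmn => prod_mono (Icc_subset_Icc_right ?_) le_rfl
  have : 1 / ((n : ℝ) + 2) ≤ 1 / ((m : ℝ) + 2) := by
    refine one_div_le_one_div_of_le (by positivity) ?_
    have : (m : ℝ) ≤ n := by exact_mod_cast hmn
    linarith
  have := mul_le_mul_of_nonneg_left this (sub_pos.2 hab).le
  linarith

/-- A signed measure on a box that is nonnegative on the strips `[a, a + ε] × [c, ∞)`, and vanishes
on the full ones, has a nonnegative integral against every continuous function that is
non-decreasing in the second coordinate. -/
theorem integral_nonneg_of_strips {lo hi : ℝ × ℝ} (hlh : lo ≤ hi) {ν : SignedMeasure (ℝ × ℝ)}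
    (hν : ν.variation (Icc lo hi)ᶜ = 0)
    (hstrip : ∀ v ∈ Icc lo hi, ∀ ε : ℝ, 0 < ε →
      0 ≤ ν (Icc v.1 (v.1 + ε) ×ˢ Ici v.2) ∧
      (v.2 = lo.2 → ν (Icc v.1 (v.1 + ε) ×ˢ Ici v.2) = 0))
    {ψ : ℝ × ℝ → ℝ} (hc : ContinuousOn ψ (Icc lo hi))
    (hm : ∀ p ∈ Icc lo hi, ∀ q ∈ Icc lo hi, p.1 = q.1 → p.2 ≤ q.2 → ψ p ≤ ψ q) :
    0 ≤ ∫ᵛ p, ψ p ∂<•ν := by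
  set α := ν.toJordanDecomposition.posPart with hα
  set β := ν.toJordanDecomposition.negPart with hβ
  have hsub : ∀ s, MeasurableSet s → ν s = α.real s - β.real s := fun s hs =>
    ν.apply_eq_posPart_real_sub_negPart_real hs
  have hnull : α (Icc lo hi)ᶜ = 0 ∧ β (Icc lo hi)ᶜ = 0 := by
    rw [← ν.totalVariation_eq_variation, SignedMeasure.totalVariation, Measure.add_apply,
      add_eq_zero] at hν
    exact hν
  have hle : ∀ v ∈ Icc lo hi, ∀ ε : ℝ, 0 < ε →
      β (Icc v.1 (v.1 + ε) ×ˢ Ici v.2) ≤ α (Icc v.1 (v.1 + ε) ×ˢ Ici v.2) := by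
    intro v hv ε hε
    have := (hstrip v hv ε hε).1
    rw [hsub _ (measurableSet_Icc.prod measurableSet_Ici), sub_nonneg, measureReal_def,
      measureReal_def, ENNReal.toReal_le_toReal (measure_ne_top _ _) (measure_ne_top _ _)] at this
    exact this
  have heq : ∀ a ∈ Icc lo.1 hi.1, ∀ ε : ℝ, 0 < ε →
      β (Icc a (a + ε) ×ˢ Ici lo.2) = α (Icc a (a + ε) ×ˢ Ici lo.2) := by
    intro a ha ε hε
    have := (hstrip (a, lo.2) ⟨⟨ha.1, le_rfl⟩, ⟨ha.2, hlh.2⟩⟩ ε hε).2 rfl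
    rw [hsub _ (measurableSet_Icc.prod measurableSet_Ici), sub_eq_zero, measureReal_def,
      measureReal_def, ENNReal.toReal_eq_toReal_iff' (measure_ne_top _ _) (measure_ne_top _ _)]
      at this
    exact this.symm
  have hcongr : ∀ γ : Measure (ℝ × ℝ), γ (Icc lo hi)ᶜ = 0 → ∀ s t : Set (ℝ × ℝ),
      s ∩ Icc lo hi = t ∩ Icc lo hi → γ s = γ t := by
    intro γ hγ s t hst
    rw [← measure_inter_add_sdiff₀ s measurableSet_Icc.nullMeasurableSet,
      ← measure_inter_add_sdiff₀ t measurableSet_Icc.nullMeasurableSet, hst,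
      measure_mono_null (sdiff_subset_compl s (Icc lo hi)) hγ,
      measure_mono_null (sdiff_subset_compl t (Icc lo hi)) hγ]
  -- The strip is first cut down so that its lower left corner dominates `lo`. If the corner lies in
  -- the box, the half-open strip is an increasing limit of closed ones; otherwise the strip misses
  -- the box and is null.
  have hIco : ∀ a b c : ℝ, β (Ico a b ×ˢ Ici c) ≤ α (Ico a b ×ˢ Ici c) := by
    intro a b c
    have hred : (Ico a b ×ˢ Ici c) ∩ Icc lo hi =
        (Ico (max a lo.1) b ×ˢ Ici (max c lo.2)) ∩ Icc lo hi := by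
      ext ⟨x, y⟩
      simp only [mem_inter_iff, mem_prod, mem_Ico, mem_Ici, mem_Icc, Prod.le_def, max_le_iff]
      tauto
    rw [hcongr β hnull.2 _ _ hred, hcongr α hnull.1 _ _ hred]
    rcases le_or_gt b (max a lo.1) with hb | hb
    · simp [Ico_eq_empty_of_le hb]
    by_cases hhi : max a lo.1 ≤ hi.1 ∧ max c lo.2 ≤ hi.2
    · refine le_of_tendsto_of_tendsto' (tendsto_measure_strip β hb _)
        (tendsto_measure_strip α hb _) fun n => ?_
      refine hle (max a lo.1, max c lo.2)
        ⟨⟨le_max_right _ _, le_max_right _ _⟩, hhi⟩ _ (mul_pos (sub_pos.2 hb) (sub_pos.2 ?_))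
      rw [div_lt_one (by positivity)]
      have : (0 : ℝ) ≤ n := n.cast_nonneg
      linarith
    · have : β (Ico (max a lo.1) b ×ˢ Ici (max c lo.2)) = 0 := by
        refine measure_mono_null ?_ hnull.2
        rintro ⟨x, y⟩ ⟨⟨h1, h2⟩, h3⟩ h4
        exact hhi ⟨h1.trans h4.2.1, le_trans h3 h4.2.2⟩
      rw [this]; exact zero_le
  have hIco' : ∀ a b : ℝ, β (Ico a b ×ˢ univ) ≤ α (Ico a b ×ˢ univ) := by
    intro a b
    have hred : (Ico a b ×ˢ univ) ∩ Icc lo hi = (Ico a b ×ˢ Ici lo.2) ∩ Icc lo hi := by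
      ext ⟨x, y⟩
      simp only [mem_inter_iff, mem_prod, mem_Ico, mem_Ici, mem_Icc, Prod.le_def, mem_univ]
      tauto
    rw [hcongr β hnull.2 _ _ hred, hcongr α hnull.1 _ _ hred]
    exact hIco _ _ _
  -- A single full strip covers the box; the `+ 1` makes its width positive even if `lo.1 = hi.1`.
  have huniv : α univ = β univ := by
    have hred : univ ∩ Icc lo hi =
        (Icc lo.1 (lo.1 + (hi.1 - lo.1 + 1)) ×ˢ Ici lo.2) ∩ Icc lo hi := by
      ext ⟨x, y⟩
      simp only [mem_inter_iff, mem_prod, mem_Ici, mem_Icc, Prod.le_def, mem_univ, true_and]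
      constructor
      · rintro ⟨⟨h1, h2⟩, h3, h4⟩
        exact ⟨⟨⟨h1, by linarith⟩, h2⟩, ⟨h1, h2⟩, h3, h4⟩
      · exact fun h => h.2
    rw [hcongr β hnull.2 _ _ hred, hcongr α hnull.1 _ _ hred]
    exact (heq _ ⟨le_rfl, hlh.1⟩ _ (by have := hlh.1; linarith)).symm
  obtain ⟨C, hC⟩ := exists_bound_comp_clamp hlh hc
  have hcont := continuous_comp_clamp hlh hc
  rw [← integral_comp_clamp hν,
    integral_eq_posPart_sub_negPart _ (integrable_of_bounded hcont hC), sub_nonneg]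
  refine integral_le_of_strips hIco hIco' huniv hcont hC fun x y z hyz => ?_
  exact hm _ (clamp_mem hlh _) _ (clamp_mem hlh _) rfl
    (max_le_max le_rfl (min_le_min hyz le_rfl))

/-! ### Integration by parts on a box -/

theorem Icc_eq_prod_Icc (lo hi : ℝ × ℝ) : Icc lo hi = Icc lo.1 hi.1 ×ˢ Icc lo.2 hi.2 :=
  (Icc_prod_eq lo hi)

theorem interior_box (lo hi : ℝ × ℝ) :
    interior (Icc lo hi) = Ioo lo.1 hi.1 ×ˢ Ioo lo.2 hi.2 := by
  rw [Icc_eq_prod_Icc, interior_prod_eq, interior_Icc, interior_Icc]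

theorem ae_mem_interior_box (lo hi : ℝ × ℝ) :
    ∀ᵐ p ∂volume.restrict (Icc lo hi), p ∈ interior (Icc lo hi) := by
  have h := (convex_Icc lo hi).addHaar_frontier volume
  rw [ae_restrict_iff' measurableSet_Icc]
  have h' : ∀ᵐ p : ℝ × ℝ, p ∉ frontier (Icc lo hi) := measure_eq_zero_iff_ae_notMem.1 h
  filter_upwards [h'] with p hp hpX
  by_contra hint
  exact hp ⟨subset_closure hpX, hint⟩

theorem restrict_box (lo hi : ℝ × ℝ) : volume.restrict (Icc lo hi) =
    (volume.restrict (Icc lo.1 hi.1)).prod (volume.restrict (Icc lo.2 hi.2)) := by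
  rw [Icc_eq_prod_Icc, Measure.prod_restrict, Measure.volume_eq_prod]

theorem integrableOn_fderiv_apply {lo hi : ℝ × ℝ} {F : ℝ × ℝ → ℝ} {C : ℝ}
    (hC : ∀ p ∈ interior (Icc lo hi), ‖fderiv ℝ F p‖ ≤ C) (v : ℝ × ℝ) :
    IntegrableOn (fun p => fderiv ℝ F p v) (Icc lo hi) := by
  refine Measure.integrableOn_of_bounded (M := C * ‖v‖) isCompact_Icc.measure_lt_top.ne
    (measurable_fderiv_apply_const ℝ F v).aestronglyMeasurable ?_
  filter_upwards [ae_mem_interior_box lo hi] with p hp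
  exact (ContinuousLinearMap.le_opNorm _ _).trans
    (mul_le_mul_of_nonneg_right (hC p hp) (norm_nonneg _))

theorem integrableOn_mul_of_continuousOn {lo hi : ℝ × ℝ} {g F : ℝ × ℝ → ℝ}
    (hg : IntegrableOn g (Icc lo hi)) (hF : ContinuousOn F (Icc lo hi)) :
    IntegrableOn (fun p => g p * F p) (Icc lo hi) :=
  hg.mul_continuousOn hF isCompact_Icc

theorem hasDerivAt_slice_fst {U : ℝ × ℝ → ℝ} {x y : ℝ} (h : DifferentiableAt ℝ U (x, y)) :
    HasDerivAt (fun t => U (t, y)) (fderiv ℝ U (x, y) (1, 0)) x := by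
  exact h.hasFDerivAt.comp_hasDerivAt x ((hasDerivAt_id x).prodMk (hasDerivAt_const x y))

/-- The mean value inequality gives the bound on the open interval, and continuity carries it to the
endpoints. The height `y` must be interior because nothing is known about derivatives on the edges.
-/
theorem lipschitzOnWith_slice_fst {lo hi : ℝ × ℝ} (h1 : lo.1 < hi.1) {F : ℝ × ℝ → ℝ}
    (hF : ContinuousOn F (Icc lo hi)) (hFd : ∀ p ∈ interior (Icc lo hi), DifferentiableAt ℝ F p)
    {C : ℝ} (hC : ∀ p ∈ interior (Icc lo hi), ‖fderiv ℝ F p‖ ≤ C) {y : ℝ}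
    (hy : y ∈ Ioo lo.2 hi.2) :
    LipschitzOnWith C.toNNReal (fun x => F (x, y)) (Icc lo.1 hi.1) := by
  rw [← closure_Ioo h1.ne, lipschitzOnWith_closure_iff]
  · have hmem : ∀ x ∈ Ioo lo.1 hi.1, (x, y) ∈ interior (Icc lo hi) := fun x hx => by
      rw [interior_box]; exact ⟨hx, hy⟩
    refine (convex_Ioo _ _).lipschitzOnWith_of_nnnorm_deriv_le
      (fun x hx => (hasDerivAt_slice_fst (hFd _ (hmem x hx))).differentiableAt) fun x hx => ?_
    rw [(hasDerivAt_slice_fst (hFd _ (hmem x hx))).deriv]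
    refine NNReal.le_toNNReal_of_coe_le ?_
    rw [coe_nnnorm]
    refine (ContinuousLinearMap.le_opNorm _ _).trans ?_
    have : ‖((1 : ℝ), (0 : ℝ))‖ = 1 := by simp [Prod.norm_def]
    rw [this, mul_one]
    exact hC _ (hmem x hx)
  · rw [closure_Ioo h1.ne]
    refine hF.comp (by fun_prop) fun x hx => ?_
    rw [Icc_eq_prod_Icc]
    exact ⟨hx, Ioo_subset_Icc_self hy⟩

theorem integrableOn_byParts {lo hi : ℝ × ℝ} {U F : ℝ × ℝ → ℝ} {K : NNReal}
    (hU : LipschitzWith K U) (hF : ContinuousOn F (Icc lo hi)) {C : ℝ}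
    (hC : ∀ p ∈ interior (Icc lo hi), ‖fderiv ℝ F p‖ ≤ C) (v : ℝ × ℝ) :
    IntegrableOn (fun p => fderiv ℝ U p v * F p + U p * fderiv ℝ F p v) (Icc lo hi) := by
  refine Integrable.add
    (integrableOn_mul_of_continuousOn (integrableOn_fderiv_apply (C := K) ?_ v) hF) ?_
  · exact fun p _ => norm_fderiv_le_of_lipschitz ℝ hU
  · have := integrableOn_mul_of_continuousOn (integrableOn_fderiv_apply hC v)
      hU.continuous.continuousOn
    simp only [mul_comm _ (U _)] at this
    exact this

/-- Integration by parts in the first coordinate on a box, for a Lipschitz function and a function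
with bounded derivative in the interior. -/
theorem integral_byParts_fst {lo hi : ℝ × ℝ} (h1 : lo.1 < hi.1) {U F : ℝ × ℝ → ℝ} {K : NNReal}
    (hU : LipschitzWith K U) (hF : ContinuousOn F (Icc lo hi))
    (hFd : ∀ p ∈ interior (Icc lo hi), DifferentiableAt ℝ F p) {C : ℝ}
    (hC : ∀ p ∈ interior (Icc lo hi), ‖fderiv ℝ F p‖ ≤ C) :
    ∫ p in Icc lo hi, (fderiv ℝ U p (1, 0) * F p + U p * fderiv ℝ F p (1, 0)) =
      ∫ y in Icc lo.2 hi.2, (U (hi.1, y) * F (hi.1, y) - U (lo.1, y) * F (lo.1, y)) := by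
  have hint := integrableOn_byParts hU hF hC (1, 0)
  rw [IntegrableOn, restrict_box] at hint
  rw [restrict_box, integral_prod_symm _ hint]
  refine integral_congr_ae ?_
  -- Rademacher's theorem, then Fubini: on almost every horizontal line, `U` is differentiable as a
  -- function of two variables at almost every point.
  have hd : ∀ᵐ p : ℝ × ℝ, DifferentiableAt ℝ U p := hU.ae_differentiableAt
  have hd' : ∀ᵐ y : ℝ, ∀ᵐ x : ℝ, DifferentiableAt ℝ U (x, y) := by
    rw [Measure.volume_eq_prod] at hd
    exact Measure.ae_ae_of_ae_prod (Measure.measurePreserving_swap.quasiMeasurePreserving.ae hd)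
  have hy : ∀ᵐ y ∂volume.restrict (Icc lo.2 hi.2), y ∈ Ioo lo.2 hi.2 := by
    rw [← Measure.restrict_congr_set Ioo_ae_eq_Icc]
    exact ae_restrict_mem measurableSet_Ioo
  filter_upwards [ae_restrict_of_ae hd', hy] with y hyd hy
  have hlipU : LipschitzWith K fun x => U (x, y) := by
    have := hU.comp (LipschitzWith.prodMk_right (α := ℝ) y)
    rwa [mul_one] at this
  -- Both factors are Lipschitz on the slice, so the one-dimensional formula for absolutely
  -- continuous functions applies.
  have hU' : AbsolutelyContinuousOnInterval (fun x => U (x, y)) lo.1 hi.1 :=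
    (hlipU.lipschitzOnWith (s := uIcc lo.1 hi.1)).absolutelyContinuousOnInterval
  have hF' : AbsolutelyContinuousOnInterval (fun x => F (x, y)) lo.1 hi.1 := by
    refine LipschitzOnWith.absolutelyContinuousOnInterval (K := C.toNNReal) ?_
    rw [uIcc_of_le h1.le]
    exact lipschitzOnWith_slice_fst h1 hF hFd hC hy
  rw [← hU'.integral_deriv_mul_eq_sub hF', intervalIntegral.integral_of_le h1.le,
    ← integral_Icc_eq_integral_Ioc]
  refine integral_congr_ae ?_
  have hx : ∀ᵐ x ∂volume.restrict (Icc lo.1 hi.1), x ∈ Ioo lo.1 hi.1 := by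
    rw [← Measure.restrict_congr_set Ioo_ae_eq_Icc]
    exact ae_restrict_mem measurableSet_Ioo
  filter_upwards [ae_restrict_of_ae hyd, hx] with x hxd hx
  have hmem : (x, y) ∈ interior (Icc lo hi) := by rw [interior_box]; exact ⟨hx, hy⟩
  rw [(hasDerivAt_slice_fst hxd).deriv, (hasDerivAt_slice_fst (hFd _ hmem)).deriv]

theorem fderiv_comp_swap_apply (F : ℝ × ℝ → ℝ) (p v : ℝ × ℝ) :
    fderiv ℝ (fun q => F q.swap) p v = fderiv ℝ F p.swap v.swap := by
  have := (ContinuousLinearEquiv.prodComm ℝ ℝ ℝ).comp_right_fderiv (f := F) (x := p)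
  exact congrArg (fun L => L v) this

theorem swap_mem_box_iff {lo hi p : ℝ × ℝ} : p.swap ∈ Icc lo.swap hi.swap ↔ p ∈ Icc lo hi := by
  simp only [mem_Icc, Prod.swap_le_swap]

theorem swap_mem_interior_box_iff {lo hi p : ℝ × ℝ} :
    p.swap ∈ interior (Icc lo.swap hi.swap) ↔ p ∈ interior (Icc lo hi) := by
  simp only [interior_box, mem_prod, Prod.fst_swap, Prod.snd_swap, and_comm]

theorem setIntegral_box_swap (lo hi : ℝ × ℝ) (g : ℝ × ℝ → ℝ) :
    ∫ p in Icc lo.swap hi.swap, g p.swap = ∫ p in Icc lo hi, g p := by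
  have h : Icc lo.swap hi.swap = Prod.swap ⁻¹' (Icc lo hi) := by
    ext p
    rw [mem_preimage, ← swap_mem_box_iff (p := p.swap), Prod.swap_swap]
  rw [h, Measure.volume_eq_prod]
  exact Measure.measurePreserving_swap.setIntegral_preimage_emb
    (MeasurableEquiv.prodComm (α := ℝ) (β := ℝ)).measurableEmbedding g _

/-- Integration by parts in the second coordinate on a box. -/
theorem integral_byParts_snd {lo hi : ℝ × ℝ} (h2 : lo.2 < hi.2) {U F : ℝ × ℝ → ℝ} {K : NNReal}
    (hU : LipschitzWith K U) (hF : ContinuousOn F (Icc lo hi))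
    (hFd : ∀ p ∈ interior (Icc lo hi), DifferentiableAt ℝ F p) {C : ℝ}
    (hC : ∀ p ∈ interior (Icc lo hi), ‖fderiv ℝ F p‖ ≤ C) :
    ∫ p in Icc lo hi, (fderiv ℝ U p (0, 1) * F p + U p * fderiv ℝ F p (0, 1)) =
      ∫ x in Icc lo.1 hi.1, (U (x, hi.2) * F (x, hi.2) - U (x, lo.2) * F (x, lo.2)) := by
  have hsw : LipschitzWith 1 (Prod.swap : ℝ × ℝ → ℝ × ℝ) := by
    refine LipschitzWith.of_dist_le_mul fun p q => ?_
    simp [Prod.dist_eq, max_comm]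
  have hmem : ∀ p ∈ interior (Icc lo.swap hi.swap), p.swap ∈ interior (Icc lo hi) := fun p hp => by
    rwa [← swap_mem_interior_box_iff, Prod.swap_swap]
  have h := integral_byParts_fst (lo := lo.swap) (hi := hi.swap) h2 (U := fun q => U q.swap)
    (F := fun q => F q.swap) (C := C) (hU.comp hsw)
    (hF.comp continuous_swap.continuousOn fun p hp => by
      rwa [← swap_mem_box_iff, Prod.swap_swap])
    (fun p hp => (hFd _ (hmem p hp)).comp p
      (ContinuousLinearEquiv.prodComm ℝ ℝ ℝ).differentiableAt)
    (fun p hp => by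
      refine ContinuousLinearMap.opNorm_le_bound _ ((norm_nonneg _).trans (hC _ (hmem p hp)))
        fun v => ?_
      rw [fderiv_comp_swap_apply]
      refine (ContinuousLinearMap.le_opNorm _ _).trans ?_
      have : ‖v.swap‖ = ‖v‖ := by simp [Prod.norm_def, max_comm]
      rw [this]
      exact mul_le_mul_of_nonneg_right (hC _ (hmem p hp)) (norm_nonneg _))
  simp only [fderiv_comp_swap_apply] at h
  rw [← setIntegral_box_swap]
  exact h

/-! ### Integration against the transformed measure -/

/-- The density is split into its positive and negative parts, which turns both sides into integrals
against finite positive measures. -/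
theorem integral_withDensityᵥ {α : Type*} [MeasurableSpace α] {m : Measure α} {ρ g : α → ℝ}
    (hρ : Integrable ρ m) (hg : Measurable g) {C : ℝ} (hC : ∀ p, ‖g p‖ ≤ C) :
    ∫ᵛ p, g p ∂<•(m.withDensityᵥ ρ) = ∫ p, ρ p * g p ∂m := by
  have h1 := isFiniteMeasure_withDensity_ofReal hρ.2
  have h2 : IsFiniteMeasure (m.withDensity fun x => ENNReal.ofReal (-ρ x)) :=
    isFiniteMeasure_withDensity_ofReal hρ.neg.2
  have h3 : AEMeasurable (fun x => ENNReal.ofReal (-ρ x)) m :=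
    hρ.aemeasurable.neg.ennreal_ofReal
  have hint : ∀ γ : Measure α, IsFiniteMeasure γ → Integrable g γ := fun γ _ =>
    Integrable.of_bound hg.aestronglyMeasurable C (Eventually.of_forall hC)
  have hb : ∀ θ : α → ℝ, Integrable θ m → Integrable (fun p => θ p * g p) m := fun θ hθ =>
    hθ.mul_bdd hg.aestronglyMeasurable (Eventually.of_forall hC)
  rw [withDensityᵥ_eq_withDensity_pos_part_sub_withDensity_neg_part hρ,
    VectorMeasure.integral_sub_vectorMeasure, VectorMeasure.integral_toSignedMeasure,
    VectorMeasure.integral_toSignedMeasure,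
    integral_withDensity_eq_integral_toReal_smul₀ hρ.aemeasurable.ennreal_ofReal
      (Eventually.of_forall fun _ => ENNReal.ofReal_lt_top),
    integral_withDensity_eq_integral_toReal_smul₀ h3
      (Eventually.of_forall fun _ => ENNReal.ofReal_lt_top), ← integral_sub]
  · refine integral_congr_ae (Eventually.of_forall fun p => ?_)
    simp only [smul_eq_mul, ENNReal.toReal_ofReal', ← sub_mul]
    rcases le_total 0 (ρ p) with h | h
    · rw [max_eq_left h, max_eq_right (neg_nonpos.2 h), sub_zero]
    · rw [max_eq_right h, max_eq_left (neg_nonneg.2 h), zero_sub, neg_neg]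
  · simpa only [smul_eq_mul, ENNReal.toReal_ofReal'] using hb _ hρ.pos_part
  · simpa only [smul_eq_mul, ENNReal.toReal_ofReal'] using hb _ hρ.neg_part
  · simpa only [VectorMeasure.Integrable, Measure.variation_toSignedMeasure] using hint _ h1
  · simpa only [VectorMeasure.Integrable, Measure.variation_toSignedMeasure] using hint _ h2

namespace IsTypeDensity

variable {lo hi : ℝ × ℝ} {f : ℝ × ℝ → ℝ}

/-- A degenerate box is Lebesgue-null and cannot carry total mass one. -/
theorem lt (hf : IsTypeDensity lo hi f) : lo.1 < hi.1 ∧ lo.2 < hi.2 := by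
  by_contra h
  have h0 : volume (Icc lo hi) = 0 := by
    rw [Icc_eq_prod_Icc, Measure.volume_eq_prod, Measure.prod_prod, Real.volume_Icc,
      Real.volume_Icc, mul_eq_zero, ENNReal.ofReal_eq_zero, ENNReal.ofReal_eq_zero]
    by_contra h'
    push Not at h'
    exact h ⟨by linarith [h'.1], by linarith [h'.2]⟩
  have := hf.integral_eq_one
  rw [Measure.restrict_eq_zero.2 h0, integral_zero_measure] at this
  exact zero_ne_one this

theorem le (hf : IsTypeDensity lo hi f) : lo ≤ hi := ⟨hf.lt.1.le, hf.lt.2.le⟩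

theorem integrableOn_divergence (hf : IsTypeDensity lo hi f) :
    IntegrableOn (fun p => fderiv ℝ f p p + 3 * f p) (Icc lo hi) := by
  obtain ⟨C, hC⟩ := hf.bounded_deriv
  -- Expanding in partial derivatives separates the bounded measurable factors `fderiv ℝ f p v`,
  -- with `v` fixed, from the continuous coordinates.
  have h : (fun p : ℝ × ℝ => fderiv ℝ f p p) =
      fun p => fderiv ℝ f p (1, 0) * p.1 + fderiv ℝ f p (0, 1) * p.2 := by
    funext p
    have : p = p.1 • ((1 : ℝ), (0 : ℝ)) + p.2 • ((0 : ℝ), (1 : ℝ)) := by ext <;> simp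
    conv_lhs => rw [this, map_add, map_smul, map_smul, ← this]
    simp only [smul_eq_mul, mul_comm]
  refine Integrable.add ?_ ((hf.continuousOn.integrableOn_compact isCompact_Icc).const_mul 3)
  rw [h]
  exact (integrableOn_mul_of_continuousOn (integrableOn_fderiv_apply hC _) (by fun_prop)).add
    (integrableOn_mul_of_continuousOn (integrableOn_fderiv_apply hC _) (by fun_prop))

theorem continuousOn_slice_fst (hf : IsTypeDensity lo hi f) {x : ℝ} (hx : x ∈ Icc lo.1 hi.1) :
    ContinuousOn (fun y => f (x, y)) (Icc lo.2 hi.2) :=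
  hf.continuousOn.comp (by fun_prop) fun y hy => by rw [Icc_eq_prod_Icc]; exact ⟨hx, hy⟩

theorem continuousOn_slice_snd (hf : IsTypeDensity lo hi f) {y : ℝ} (hy : y ∈ Icc lo.2 hi.2) :
    ContinuousOn (fun x => f (x, y)) (Icc lo.1 hi.1) :=
  hf.continuousOn.comp (by fun_prop) fun x hx => by rw [Icc_eq_prod_Icc]; exact ⟨hx, hy⟩

/-- The transformed measure is carried by the box. -/
theorem variation_transformedMeasure_compl (hf : IsTypeDensity lo hi f) :
    (transformedMeasure lo hi f).variation (Icc lo hi)ᶜ = 0 := by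
  rw [VectorMeasure.variation_apply_eq_zero measurableSet_Icc.compl]
  intro t ht htm
  have hlo : lo ∉ t := fun h => ht h ⟨le_rfl, hf.le⟩
  have hedge : ∀ (m : Measure ℝ) (s : Set ℝ), MeasurableSet s → ∀ (ρ : ℝ → ℝ) (φ : ℝ → ℝ × ℝ),
      Measurable φ → (∀ y ∈ s, φ y ∈ Icc lo hi) →
      ((m.restrict s).withDensityᵥ ρ).map φ t = 0 := by
    intro m s hs ρ φ hφ hmem
    rw [VectorMeasure.map_apply _ hφ htm]
    by_cases hρ : Integrable ρ (m.restrict s)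
    · rw [withDensityᵥ_apply hρ (hφ htm), Measure.restrict_restrict (hφ htm)]
      have : φ ⁻¹' t ∩ s = ∅ := by
        ext y
        simp only [mem_inter_iff, mem_preimage, mem_empty_iff_false, iff_false, not_and]
        exact fun h1 h2 => ht h1 (hmem y h2)
      rw [this, Measure.restrict_empty, integral_zero_measure]
    -- By convention a non-integrable density gives the zero measure.
    · rw [Measure.withDensityᵥ, dif_neg hρ]; rfl
  have hlt := hf.lt
  simp only [transformedMeasure, add_apply, sub_apply]
  rw [hedge _ _ measurableSet_Icc _ (fun y => (hi.1, y)) (by fun_prop)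
      fun y hy => ⟨⟨hlt.1.le, hy.1⟩, le_rfl, hy.2⟩,
    hedge _ _ measurableSet_Icc _ (fun y => (lo.1, y)) (by fun_prop)
      fun y hy => ⟨⟨le_rfl, hy.1⟩, hlt.1.le, hy.2⟩,
    hedge _ _ measurableSet_Icc _ (fun x => (x, hi.2)) (by fun_prop)
      fun x hx => ⟨⟨hx.1, hlt.2.le⟩, hx.2, le_rfl⟩,
    hedge _ _ measurableSet_Icc _ (fun x => (x, lo.2)) (by fun_prop)
      fun x hx => ⟨⟨hx.1, le_rfl⟩, hx.2, hlt.2.le⟩,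
    withDensityᵥ_apply hf.integrableOn_divergence htm, Measure.restrict_restrict htm,
    VectorMeasure.dirac_apply_of_notMem hlo]
  have : t ∩ Icc lo hi = ∅ := (disjoint_left.2 fun p h1 h2 => ht h1 h2).inter_eq
  simp [this]

theorem integral_transformedMeasure (hf : IsTypeDensity lo hi f) {U : ℝ × ℝ → ℝ}
    (hU : Continuous U) {C : ℝ} (hC : ∀ p, ‖U p‖ ≤ C) :
    ∫ᵛ p, U p ∂<•(transformedMeasure lo hi f) =
      (∫ y in Icc lo.2 hi.2, hi.1 * f (hi.1, y) * U (hi.1, y))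
      - (∫ y in Icc lo.2 hi.2, lo.1 * f (lo.1, y) * U (lo.1, y))
      + (∫ x in Icc lo.1 hi.1, hi.2 * f (x, hi.2) * U (x, hi.2))
      - (∫ x in Icc lo.1 hi.1, lo.2 * f (x, lo.2) * U (x, lo.2))
      - (∫ p in Icc lo hi, (fderiv ℝ f p p + 3 * f p) * U p)
      + U lo := by
  have hlt := hf.lt
  have hi' : ∀ ν : SignedMeasure (ℝ × ℝ), ν.Integrable U := fun ν => integrable_of_bounded hU hC
  have hedge : ∀ (ν : SignedMeasure ℝ) (φ : ℝ → ℝ × ℝ), Continuous φ →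
      ∫ᵛ p, U p ∂<•(ν.map φ) = ∫ᵛ y, U (φ y) ∂<•ν := by
    intro ν φ hφ
    have := isFiniteMeasure_variation ν
    refine VectorMeasure.integral_map hφ.measurable hU.aestronglyMeasurable ?_
    exact Integrable.of_bound (hU.comp hφ).aestronglyMeasurable C
      (Eventually.of_forall fun _ => hC _)
  have hslice : ∀ (a b c : ℝ) (g : ℝ → ℝ) (φ : ℝ → ℝ × ℝ), Continuous φ →
      ContinuousOn g (Icc a b) →
      ∫ᵛ p, U p ∂<•(((volume.restrict (Icc a b)).withDensityᵥ fun y => c * g y).map φ) =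
        ∫ y in Icc a b, c * g y * U (φ y) := by
    intro a b c g φ hφ hg
    rw [hedge _ _ hφ, integral_withDensityᵥ (g := fun y => U (φ y))
      ((hg.integrableOn_compact isCompact_Icc).const_mul c) (hU.comp hφ).measurable fun _ => hC _]
  rw [transformedMeasure, VectorMeasure.integral_add_vectorMeasure (hi' _) (hi' _),
    VectorMeasure.integral_sub_vectorMeasure (hi' _) (hi' _),
    VectorMeasure.integral_sub_vectorMeasure (hi' _) (hi' _),
    VectorMeasure.integral_add_vectorMeasure (hi' _) (hi' _),
    VectorMeasure.integral_sub_vectorMeasure (hi' _) (hi' _),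
    hslice _ _ _ (fun y => f (hi.1, y)) _ (by fun_prop)
      (hf.continuousOn_slice_fst ⟨hlt.1.le, le_rfl⟩),
    hslice _ _ _ (fun y => f (lo.1, y)) _ (by fun_prop)
      (hf.continuousOn_slice_fst ⟨le_rfl, hlt.1.le⟩),
    hslice _ _ _ (fun x => f (x, hi.2)) _ (by fun_prop)
      (hf.continuousOn_slice_snd ⟨hlt.2.le, le_rfl⟩),
    hslice _ _ _ (fun x => f (x, lo.2)) _ (by fun_prop)
      (hf.continuousOn_slice_snd ⟨le_rfl, hlt.2.le⟩),
    integral_withDensityᵥ hf.integrableOn_divergence hU.measurable hC,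
    VectorMeasure.integral_dirac]
  simp

end IsTypeDensity

/-! ### Utilities of incentive compatible mechanisms -/

namespace Mechanism

variable {lo hi : ℝ × ℝ} {M : Mechanism (Icc lo hi)}

/-- The allocation is a subgradient of the utility. -/
theorem IsIC.utility_add_le (hM : M.IsIC) {p q : ℝ × ℝ} (hp : p ∈ Icc lo hi) (hq : q ∈ Icc lo hi) :
    M.utility q + (p.1 - q.1) * (M.alloc q).1 + (p.2 - q.2) * (M.alloc q).2 ≤ M.utility p := by
  have := hM p hp q hq
  simp only [utility, payoff] at *
  linarith

theorem alloc_bounds (M : Mechanism (Icc lo hi)) {p : ℝ × ℝ} (hp : p ∈ Icc lo hi) :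
    (0 ≤ (M.alloc p).1 ∧ (M.alloc p).1 ≤ 1) ∧ (0 ≤ (M.alloc p).2 ∧ (M.alloc p).2 ≤ 1) :=
  have h := M.alloc_mem p hp
  ⟨⟨h.1.1, h.2.1⟩, ⟨h.1.2, h.2.2⟩⟩

theorem IsIC.convexOn_utility (hM : M.IsIC) : ConvexOn ℝ (Icc lo hi) M.utility := by
  refine ⟨convex_Icc lo hi, fun p hp q hq a b ha hb hab => ?_⟩
  have hr : a • p + b • q ∈ Icc lo hi := convex_Icc lo hi hp hq ha hb hab
  have h1 := mul_le_mul_of_nonneg_left (hM.utility_add_le hp hr) ha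
  have h2 := mul_le_mul_of_nonneg_left (hM.utility_add_le hq hr) hb
  simp only [smul_eq_mul]
  have e1 : (a • p + b • q).1 = a * p.1 + b * q.1 := rfl
  have e2 : (a • p + b • q).2 = a * p.2 + b * q.2 := rfl
  generalize a • p + b • q = r at *
  obtain rfl : b = 1 - a := by linarith
  rw [e1, e2] at h1 h2
  linear_combination h1 + h2

theorem IsIC.monotoneOn_utility (hM : M.IsIC) : MonotoneOn M.utility (Icc lo hi) := by
  intro p hp q hq hpq
  have h := hM.utility_add_le hq hp
  obtain ⟨⟨h1, -⟩, h2, -⟩ := M.alloc_bounds hp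
  have := mul_nonneg (sub_nonneg.2 hpq.1) h1
  have := mul_nonneg (sub_nonneg.2 hpq.2) h2
  linarith

theorem IsIC.utility_sub_le (hM : M.IsIC) {p q : ℝ × ℝ} (hp : p ∈ Icc lo hi) (hq : q ∈ Icc lo hi)
    (hpq : p ≤ q) : M.utility q - M.utility p ≤ (q.1 - p.1) + (q.2 - p.2) := by
  have h := hM.utility_add_le hp hq
  obtain ⟨⟨-, h1⟩, -, h2⟩ := M.alloc_bounds hq
  have := mul_le_mul_of_nonneg_left h1 (sub_nonneg.2 hpq.1)
  have := mul_le_mul_of_nonneg_left h2 (sub_nonneg.2 hpq.2)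
  linarith

/-- The distance on the product is the maximum of the coordinate distances, whence the factor `2`.
-/
theorem IsIC.utility_sub_le_dist (hM : M.IsIC) {p q : ℝ × ℝ} (hp : p ∈ Icc lo hi)
    (hq : q ∈ Icc lo hi) : M.utility q - M.utility p ≤ 2 * dist q p := by
  have h := hM.utility_add_le hp hq
  obtain ⟨⟨h1, h1'⟩, h2, h2'⟩ := M.alloc_bounds hq
  have e1 : |q.1 - p.1| ≤ dist q p := le_max_left _ _
  have e2 : |q.2 - p.2| ≤ dist q p := le_max_right _ _
  have key : ∀ a g : ℝ, 0 ≤ g → g ≤ 1 → a * g ≤ |a| := fun a g hg hg' =>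
    (mul_le_mul_of_nonneg_right (le_abs_self a) hg).trans
      (mul_le_of_le_one_right (abs_nonneg a) hg')
  have := key (q.1 - p.1) _ h1 h1'
  have := key (q.2 - p.2) _ h2 h2'
  linarith

theorem IsIC.lipschitzOnWith_utility (hM : M.IsIC) :
    LipschitzOnWith 2 M.utility (Icc lo hi) := by
  refine LipschitzOnWith.of_dist_le_mul fun p hp q hq => ?_
  have h1 := hM.utility_sub_le_dist hp hq
  have h2 := hM.utility_sub_le_dist hq hp
  rw [dist_comm q p] at h1
  rw [Real.dist_eq, abs_le]
  push_cast
  constructor <;> linarith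

theorem IsIC.continuousOn_utility (hM : M.IsIC) : ContinuousOn M.utility (Icc lo hi) :=
  hM.lipschitzOnWith_utility.continuousOn

/-- The extension of the utility to the plane that is constant along the fibres of the projection
onto the box. -/
noncomputable def extendedUtility (M : Mechanism (Icc lo hi)) (p : ℝ × ℝ) : ℝ :=
  M.utility (clamp lo hi p)

theorem extendedUtility_of_mem {p : ℝ × ℝ} (hp : p ∈ Icc lo hi) :
    M.extendedUtility p = M.utility p := by
  rw [extendedUtility, clamp_of_mem hp]

theorem IsIC.lipschitzWith_extendedUtility (hM : M.IsIC) (h : lo ≤ hi) :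
    LipschitzWith 2 M.extendedUtility := by
  rw [← lipschitzOnWith_univ]
  have := hM.lipschitzOnWith_utility.comp (lipschitzOnWith_univ.2 (lipschitzWith_clamp lo hi))
    fun p _ => clamp_mem h p
  rwa [mul_one] at this

/-- In the interior of the box, the allocation is the gradient of the utility. -/
theorem IsIC.fderiv_extendedUtility (hM : M.IsIC) {p : ℝ × ℝ} (hp : p ∈ interior (Icc lo hi))
    (hd : DifferentiableAt ℝ M.extendedUtility p) (v : ℝ × ℝ) :
    fderiv ℝ M.extendedUtility p v = (M.alloc p).1 * v.1 + (M.alloc p).2 * v.2 := by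
  set L : ℝ × ℝ →L[ℝ] ℝ := (M.alloc p).1 • ContinuousLinearMap.fst ℝ ℝ ℝ
    + (M.alloc p).2 • ContinuousLinearMap.snd ℝ ℝ ℝ with hL
  have hLv : ∀ v, L v = (M.alloc p).1 * v.1 + (M.alloc p).2 * v.2 := fun v => by simp [hL]
  -- The subgradient inequality says that the utility minus the linear functional `L` is smallest at
  -- `p`, so its derivative vanishes there.
  have hmin : IsLocalMin (fun q => M.extendedUtility q - L q) p := by
    filter_upwards [mem_interior_iff_mem_nhds.1 hp] with q hq
    have hpX := interior_subset hp
    have := hM.utility_add_le hq hpX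
    rw [extendedUtility_of_mem hpX, extendedUtility_of_mem hq, hLv, hLv]
    linarith
  have h0 := hmin.hasFDerivAt_eq_zero (hd.hasFDerivAt.sub L.hasFDerivAt)
  rw [sub_eq_zero] at h0
  rw [h0, hLv]

/-- The right side depends only on the utility function. Hence the utility determines the allocation
almost everywhere, and the price with it. -/
theorem IsIC.ae_alloc_eq (hM : M.IsIC) (h : lo ≤ hi) :
    ∀ᵐ p ∂volume.restrict (Icc lo hi), M.alloc p =
      (fderiv ℝ M.extendedUtility p (1, 0), fderiv ℝ M.extendedUtility p (0, 1)) := by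
  have hd : ∀ᵐ p : ℝ × ℝ, DifferentiableAt ℝ M.extendedUtility p :=
    (hM.lipschitzWith_extendedUtility h).ae_differentiableAt
  filter_upwards [ae_restrict_of_ae hd, ae_mem_interior_box lo hi] with p hpd hp
  rw [hM.fderiv_extendedUtility hp hpd, hM.fderiv_extendedUtility hp hpd]
  ext <;> simp

theorem price_eq (M : Mechanism (Icc lo hi)) (p : ℝ × ℝ) :
    M.price p = p.1 * (M.alloc p).1 + p.2 * (M.alloc p).2 - M.utility p := by
  simp [utility, payoff]

end Mechanism

/-! ### The expected revenue -/

/-- Taken with `ℓ` a coordinate projection, this supplies the derivative bound needed to integrate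
by parts against `x f` and `y f`. -/
theorem exists_norm_fderiv_mul_le {lo hi : ℝ × ℝ} {f : ℝ × ℝ → ℝ} (hf : IsTypeDensity lo hi f)
    {ℓ : ℝ × ℝ →L[ℝ] ℝ} (hℓ : ‖ℓ‖ ≤ 1) : ∃ C, ∀ p ∈ interior (Icc lo hi),
      ‖fderiv ℝ (fun q => ℓ q * f q) p‖ ≤ C := by
  obtain ⟨C, hC⟩ := hf.bounded_deriv
  obtain ⟨D, hD⟩ := isCompact_Icc.exists_bound_of_continuousOn hf.continuousOn
  obtain ⟨E, hE⟩ := (isCompact_Icc (a := lo) (b := hi)).exists_bound_of_continuousOn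
    ℓ.continuous.continuousOn
  refine ⟨E * C + D * 1, fun p hp => ?_⟩
  have hpX := interior_subset hp
  have hd : HasFDerivAt (fun q => ℓ q * f q) (ℓ p • fderiv ℝ f p + f p • ℓ) p :=
    ℓ.hasFDerivAt.mul (hf.differentiableAt p hp).hasFDerivAt
  rw [hd.fderiv]
  refine (norm_add_le _ _).trans (add_le_add ?_ ?_)
  · rw [norm_smul]
    exact mul_le_mul (hE p hpX) (hC p hp) (norm_nonneg _) ((norm_nonneg _).trans (hE p hpX))
  · rw [norm_smul]
    exact mul_le_mul (hD p hpX) hℓ (norm_nonneg _) ((norm_nonneg _).trans (hD p hpX))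

/-- The expected revenue of an incentive compatible mechanism is the integral of its utility against
the transformed measure, minus the utility of the lowest type. -/
theorem revenue_eq {lo hi : ℝ × ℝ} {f : ℝ × ℝ → ℝ} (hf : IsTypeDensity lo hi f)
    {M : Mechanism (Icc lo hi)} (hM : M.IsIC) :
    IntegrableOn (fun p => M.price p * f p) (Icc lo hi) ∧
      M.revenue f = ∫ᵛ p, M.utility p ∂<•(transformedMeasure lo hi f) - M.utility lo := by
  have hle := hf.le
  have hlt := hf.lt
  set U := M.extendedUtility with hUdef
  have hU : LipschitzWith 2 U := hM.lipschitzWith_extendedUtility hle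
  obtain ⟨C, hC⟩ : ∃ C, ∀ p, ‖U p‖ ≤ C := exists_bound_comp_clamp hle hM.continuousOn_utility
  obtain ⟨C₁, hC₁⟩ := exists_norm_fderiv_mul_le hf
    (ContinuousLinearMap.norm_fst_le ℝ ℝ ℝ)
  obtain ⟨C₂, hC₂⟩ := exists_norm_fderiv_mul_le hf
    (ContinuousLinearMap.norm_snd_le ℝ ℝ ℝ)
  have hd₁ : ∀ p ∈ interior (Icc lo hi), HasFDerivAt (fun q : ℝ × ℝ => q.1 * f q)
      (p.1 • fderiv ℝ f p + f p • ContinuousLinearMap.fst ℝ ℝ ℝ) p := fun p hp =>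
    (hasFDerivAt_fst (𝕜 := ℝ) (p := p)).mul (hf.differentiableAt p hp).hasFDerivAt
  have hd₂ : ∀ p ∈ interior (Icc lo hi), HasFDerivAt (fun q : ℝ × ℝ => q.2 * f q)
      (p.2 • fderiv ℝ f p + f p • ContinuousLinearMap.snd ℝ ℝ ℝ) p := fun p hp =>
    (hasFDerivAt_snd (𝕜 := ℝ) (p := p)).mul (hf.differentiableAt p hp).hasFDerivAt
  have hc₁ : ContinuousOn (fun q : ℝ × ℝ => q.1 * f q) (Icc lo hi) :=
    continuous_fst.continuousOn.mul hf.continuousOn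
  have hc₂ : ContinuousOn (fun q : ℝ × ℝ => q.2 * f q) (Icc lo hi) :=
    continuous_snd.continuousOn.mul hf.continuousOn
  have hint₁ := integrableOn_byParts hU hc₁ hC₁ (1, 0)
  have hint₂ := integrableOn_byParts hU hc₂ hC₂ (0, 1)
  have hint₃ := integrableOn_mul_of_continuousOn hf.integrableOn_divergence
    hU.continuous.continuousOn
  -- Pointwise, `(∇U · p - U) f = div(U f p) - (∇f · p + 3 f) U`. Of the `3`, two units come from
  -- the divergence of `p` and one from the term `-U f` of the price.
  have hae : ∀ᵐ p ∂volume.restrict (Icc lo hi), M.price p * f p =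
      (fderiv ℝ U p (1, 0) * (p.1 * f p) + U p * fderiv ℝ (fun q => q.1 * f q) p (1, 0))
      + (fderiv ℝ U p (0, 1) * (p.2 * f p) + U p * fderiv ℝ (fun q => q.2 * f q) p (0, 1))
      - (fderiv ℝ f p p + 3 * f p) * U p := by
    filter_upwards [hM.ae_alloc_eq hle, ae_mem_interior_box lo hi] with p ha hp
    have hpU : U p = M.utility p := Mechanism.extendedUtility_of_mem (interior_subset hp)
    have hpp : fderiv ℝ f p p = p.1 * fderiv ℝ f p (1, 0) + p.2 * fderiv ℝ f p (0, 1) := by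
      have : p = p.1 • ((1 : ℝ), (0 : ℝ)) + p.2 • ((0 : ℝ), (1 : ℝ)) := by ext <;> simp
      conv_lhs => rw [this, map_add, map_smul, map_smul, ← this]
      rfl
    rw [M.price_eq, ha, (hd₁ p hp).fderiv, (hd₂ p hp).fderiv, hpp, hpU]
    simp only [add_apply, smul_apply, smul_eq_mul, ContinuousLinearMap.coe_fst',
      ContinuousLinearMap.coe_snd']
    ring
  have hint := (hint₁.add hint₂).sub hint₃
  refine ⟨hint.congr (hae.mono fun p hp => hp.symm), ?_⟩
  have hμ := hf.variation_transformedMeasure_compl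
  rw [← integral_comp_clamp hμ]
  have h4 := hf.integral_transformedMeasure hU.continuous hC
  have hUlo : U lo = M.utility lo := Mechanism.extendedUtility_of_mem ⟨le_rfl, hle⟩
  have h5 := integral_sub (hint₁.add hint₂) hint₃
  simp only [Pi.add_apply] at h5
  rw [show (∫ᵛ p, M.utility (clamp lo hi p) ∂<•(transformedMeasure lo hi f)) =
      ∫ᵛ p, U p ∂<•(transformedMeasure lo hi f) from rfl, h4, Mechanism.revenue,
    integral_congr_ae hae, h5, integral_add hint₁ hint₂,
    integral_byParts_fst hlt.1 hU hc₁ (fun p hp => (hd₁ p hp).differentiableAt) hC₁,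
    integral_byParts_snd hlt.2 hU hc₂ (fun p hp => (hd₂ p hp).differentiableAt) hC₂, hUlo]
  have hs₁ : ∀ x ∈ Icc lo.1 hi.1, IntegrableOn (fun y => U (x, y) * (x * f (x, y)))
      (Icc lo.2 hi.2) := fun x hx =>
    ((hU.continuous.comp (by fun_prop)).continuousOn.mul
      ((hf.continuousOn_slice_fst hx).const_mul x)).integrableOn_compact isCompact_Icc
  have hs₂ : ∀ y ∈ Icc lo.2 hi.2, IntegrableOn (fun x => U (x, y) * (y * f (x, y)))
      (Icc lo.1 hi.1) := fun y hy =>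
    ((hU.continuous.comp (by fun_prop)).continuousOn.mul
      ((hf.continuousOn_slice_snd hy).const_mul y)).integrableOn_compact isCompact_Icc
  rw [integral_sub (hs₁ _ ⟨hlt.1.le, le_rfl⟩) (hs₁ _ ⟨le_rfl, hlt.1.le⟩),
    integral_sub (hs₂ _ ⟨hlt.2.le, le_rfl⟩) (hs₂ _ ⟨le_rfl, hlt.2.le⟩)]
  simp only [mul_comm (U _)]
  ring

/-! ### Geometry of exclusion sets -/

namespace IsExclusionSet

variable {lo hi : ℝ × ℝ} {Z : Set (ℝ × ℝ)}

theorem nonempty (hZ : IsExclusionSet lo hi Z) : Z.Nonempty :=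
  hZ.nonempty_interior.mono interior_subset

theorem le (hZ : IsExclusionSet lo hi Z) : lo ≤ hi :=
  let ⟨_, hz⟩ := hZ.nonempty
  (hZ.subset hz).1.trans (hZ.subset hz).2

theorem lo_mem (hZ : IsExclusionSet lo hi Z) : lo ∈ Z :=
  let ⟨z, hz⟩ := hZ.nonempty
  hZ.decreasing lo ⟨le_rfl, hZ.le⟩ z hz (hZ.subset hz).1

protected theorem swap (hZ : IsExclusionSet lo hi Z) :
    IsExclusionSet lo.swap hi.swap (Prod.swap ⁻¹' Z) where
  subset p hp := by
    have := hZ.subset hp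
    rwa [← swap_mem_box_iff, Prod.swap_swap] at this
  convex := hZ.convex.is_linear_preimage
    (ContinuousLinearEquiv.prodComm ℝ ℝ ℝ).toLinearEquiv.toLinearMap.isLinear
  isCompact := (Homeomorph.prodComm ℝ ℝ).isCompact_preimage.2 hZ.isCompact
  decreasing a ha b hb hab := by
    refine hZ.decreasing a.swap ?_ b.swap hb (Prod.swap_le_swap.2 hab)
    rwa [← swap_mem_box_iff, Prod.swap_swap]
  nonempty_interior := by
    have := (Homeomorph.prodComm ℝ ℝ).preimage_interior Z
    change Prod.swap ⁻¹' interior Z = interior (Prod.swap ⁻¹' Z) at this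
    rw [← this]
    obtain ⟨z, hz⟩ := hZ.nonempty_interior
    exact ⟨z.swap, by rwa [mem_preimage, Prod.swap_swap]⟩

theorem isCompact_image_add (hZ : IsExclusionSet lo hi Z) :
    IsCompact ((fun z : ℝ × ℝ => z.1 + z.2) '' Z) :=
  hZ.isCompact.image (by fun_prop)

theorem add_le_criticalPrice (hZ : IsExclusionSet lo hi Z) {z : ℝ × ℝ} (hz : z ∈ Z) :
    z.1 + z.2 ≤ criticalPrice Z :=
  le_csSup hZ.isCompact_image_add.bddAbove (mem_image_of_mem _ hz)

theorem criticalPrice_swap : criticalPrice (Prod.swap ⁻¹' Z) = criticalPrice Z := by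
  unfold criticalPrice
  congr 1
  ext t
  constructor
  · rintro ⟨z, hz, rfl⟩; exact ⟨z.swap, hz, add_comm _ _⟩
  · rintro ⟨z, hz, rfl⟩; exact ⟨z.swap, by rwa [mem_preimage, Prod.swap_swap], add_comm _ _⟩

theorem xCrit_swap : xCrit (Prod.swap ⁻¹' Z) = yCrit Z := by
  unfold xCrit yCrit
  rw [criticalPrice_swap]
  rfl

theorem isCompact_criticalSegment (hZ : IsExclusionSet lo hi Z) :
    IsCompact {x | (x, criticalPrice Z - x) ∈ Z} := by
  refine (isCompact_Icc (a := lo.1) (b := hi.1)).of_isClosed_subset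
    (hZ.isCompact.isClosed.preimage (by fun_prop)) fun x hx => ?_
  have := hZ.subset hx
  exact ⟨this.1.1, this.2.1⟩

theorem xCrit_mem (hZ : IsExclusionSet lo hi Z) : (xCrit Z, criticalPrice Z - xCrit Z) ∈ Z := by
  obtain ⟨z, hz, hzP⟩ := hZ.isCompact_image_add.sSup_mem (hZ.nonempty.image _)
  refine hZ.isCompact_criticalSegment.sInf_mem ⟨z.1, ?_⟩
  have : criticalPrice Z - z.1 = z.2 := by
    rw [criticalPrice, ← hzP]; simp
  change (z.1, criticalPrice Z - z.1) ∈ Z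
  rwa [this]

theorem yCrit_mem (hZ : IsExclusionSet lo hi Z) : (criticalPrice Z - yCrit Z, yCrit Z) ∈ Z := by
  have := hZ.swap.xCrit_mem
  rwa [xCrit_swap, criticalPrice_swap] at this

theorem xCrit_le (hZ : IsExclusionSet lo hi Z) {x : ℝ} (hx : (x, criticalPrice Z - x) ∈ Z) :
    xCrit Z ≤ x :=
  csInf_le hZ.isCompact_criticalSegment.bddBelow hx

/-- The point of `Z` defining `yCrit` also lies on the critical line, so its abscissa competes in
the minimum defining `xCrit`. This is what keeps `𝒜` and `ℬ` apart. -/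
theorem xCrit_add_yCrit_le (hZ : IsExclusionSet lo hi Z) : xCrit Z + yCrit Z ≤ criticalPrice Z := by
  have : xCrit Z ≤ criticalPrice Z - yCrit Z :=
    hZ.xCrit_le (by rw [_root_.sub_sub_cancel]; exact hZ.yCrit_mem)
  linarith

theorem mem_of_lt_crit (hZ : IsExclusionSet lo hi Z) {p : ℝ × ℝ} (hp : p ∈ Icc lo hi)
    (h1 : p.1 ≤ xCrit Z) (h2 : p.2 ≤ yCrit Z) : p ∈ Z :=
  hZ.decreasing p hp _ hZ.xCrit_mem ⟨h1, h2.trans (by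
    have := hZ.xCrit_add_yCrit_le
    show yCrit Z ≤ criticalPrice Z - xCrit Z
    linarith)⟩

theorem mem_criticalSegment (hZ : IsExclusionSet lo hi Z) {x : ℝ} (h1 : xCrit Z ≤ x)
    (h2 : x ≤ criticalPrice Z - yCrit Z) : (x, criticalPrice Z - x) ∈ Z := by
  have hconv : Convex ℝ {x | (x, criticalPrice Z - x) ∈ Z} := by
    intro x hx y hy a b ha hb hab
    have := hZ.convex hx hy ha hb hab
    have e : a • (x, criticalPrice Z - x) + b • (y, criticalPrice Z - y) =
        (a • x + b • y, criticalPrice Z - (a • x + b • y)) := by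
      ext
      · simp
      · simp only [Prod.snd_add, Prod.smul_snd, smul_eq_mul]
        linear_combination criticalPrice Z * hab
    rwa [e] at this
  refine hconv.ordConnected.out hZ.xCrit_mem ?_ ⟨h1, h2⟩
  change (_, criticalPrice Z - (criticalPrice Z - yCrit Z)) ∈ Z
  rw [_root_.sub_sub_cancel]
  exact hZ.yCrit_mem

/-- Every type of the region `𝒲` lies above a point of `Z` at the critical price. -/
theorem exists_le_of_mem_regionW (hZ : IsExclusionSet lo hi Z) {p : ℝ × ℝ} (hp : p ∈ Icc lo hi)
    (h1 : xCrit Z ≤ p.1) (h2 : yCrit Z ≤ p.2) (hpZ : p ∉ Z) :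
    ∃ z ∈ Z, z ≤ p ∧ z.1 + z.2 = criticalPrice Z := by
  have h12 := hZ.xCrit_add_yCrit_le
  rcases le_total p.1 (criticalPrice Z - yCrit Z) with h | h
  · have hz := hZ.mem_criticalSegment h1 h
    refine ⟨_, hz, ⟨le_rfl, ?_⟩, by simp⟩
    show criticalPrice Z - p.1 ≤ p.2
    by_contra hlt
    exact hpZ (hZ.decreasing p hp _ hz ⟨le_rfl, (not_le.1 hlt).le⟩)
  · exact ⟨_, hZ.yCrit_mem, ⟨h, h2⟩, by simp⟩

/-! #### The outer boundary function -/

theorem isCompact_slice (hZ : IsExclusionSet lo hi Z) (x : ℝ) : IsCompact {y | (x, y) ∈ Z} := by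
  refine (isCompact_Icc (a := lo.2) (b := hi.2)).of_isClosed_subset
    (hZ.isCompact.isClosed.preimage (by fun_prop)) fun y hy => ?_
  have := hZ.subset hy
  exact ⟨this.1.2, this.2.2⟩

theorem le_outerBoundary₁ (hZ : IsExclusionSet lo hi Z) {z : ℝ × ℝ} (hz : z ∈ Z) :
    z.2 ≤ outerBoundary₁ Z z.1 :=
  le_csSup (hZ.isCompact_slice z.1).bddAbove hz

theorem outerBoundary₁_mem (hZ : IsExclusionSet lo hi Z) {x : ℝ} (hx : x ∈ Prod.fst '' Z) :
    (x, outerBoundary₁ Z x) ∈ Z := by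
  obtain ⟨z, hz, rfl⟩ := hx
  exact (hZ.isCompact_slice z.1).sSup_mem ⟨z.2, hz⟩

theorem concaveOn_outerBoundary₁ (hZ : IsExclusionSet lo hi Z) :
    ConcaveOn ℝ (Prod.fst '' Z) (outerBoundary₁ Z) := by
  refine ⟨hZ.convex.is_linear_image (LinearMap.fst ℝ ℝ ℝ).isLinear,
    fun x hx y hy a b ha hb hab => ?_⟩
  exact hZ.le_outerBoundary₁
    (hZ.convex (hZ.outerBoundary₁_mem hx) (hZ.outerBoundary₁_mem hy) ha hb hab)

theorem mem_of_le_xCrit (hZ : IsExclusionSet lo hi Z) {x : ℝ} (hx : x ∈ Icc lo.1 (xCrit Z)) :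
    x ∈ Prod.fst '' Z := by
  have h := hZ.xCrit_mem
  have hX := hZ.subset h
  exact ⟨(x, lo.2), hZ.decreasing _ ⟨⟨hx.1, le_rfl⟩, hx.2.trans hX.2.1, hZ.le.2⟩ _ h
    ⟨hx.2, hX.1.2⟩, rfl⟩

theorem antitoneOn_outerBoundary₁ (hZ : IsExclusionSet lo hi Z) :
    AntitoneOn (outerBoundary₁ Z) (Prod.fst '' Z) := by
  intro x hx y hy hxy
  have h := hZ.outerBoundary₁_mem hy
  have hX := hZ.subset h
  have hx1 : lo.1 ≤ x := by
    obtain ⟨z, hz, rfl⟩ := hx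
    exact (hZ.subset hz).1.1
  exact hZ.le_outerBoundary₁ (z := (x, outerBoundary₁ Z y)) (hZ.decreasing _
    ⟨⟨hx1, hX.1.2⟩, hxy.trans hX.2.1, hX.2.2⟩ _ h ⟨hxy, le_rfl⟩)

/-- Left of the critical point, the outer boundary function has a right derivative with values in
`[-1, 0]`, and the corresponding tangent line lies above `Z`. -/
theorem exists_rightDeriv (hZ : IsExclusionSet lo hi Z) {x : ℝ} (hx : x ∈ Ico lo.1 (xCrit Z)) :
    ∃ d, (-1 ≤ d ∧ d ≤ 0) ∧ HasDerivWithinAt (outerBoundary₁ Z) d (Ici x) x ∧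
      ∀ z ∈ Z, z.2 ≤ outerBoundary₁ Z x + d * (z.1 - x) := by
  set s := outerBoundary₁ Z with hs
  have hconc := hZ.concaveOn_outerBoundary₁
  have hxS := hZ.mem_of_le_xCrit ⟨hx.1, hx.2.le⟩
  have hxcS := hZ.mem_of_le_xCrit ⟨hx.1.trans hx.2.le, le_rfl⟩
  have hmem : ∀ t ∈ Ioo x (xCrit Z), t ∈ Prod.fst '' Z := fun t ht =>
    hZ.mem_of_le_xCrit ⟨hx.1.trans ht.1.le, ht.2.le⟩
  have hsub : Ioo x (xCrit Z) ⊆ {y | y ∈ Prod.fst '' Z ∧ x < y} := fun t ht => ⟨hmem t ht, ht.1⟩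
  have hanti : AntitoneOn (slope s x) (Ioo x (xCrit Z)) :=
    (hconc.antitoneOn_slope_gt hxS).mono hsub
  have hle0 : ∀ t ∈ Ioo x (xCrit Z), slope s x t ≤ 0 := fun t ht => by
    rw [slope_def_field]
    exact div_nonpos_of_nonpos_of_nonneg
      (sub_nonpos.2 (hZ.antitoneOn_outerBoundary₁ hxS (hmem t ht) ht.1.le)) (sub_nonneg.2 ht.1.le)
  -- By concavity the slope is at least that of the chord ending at `xCrit Z`. That chord starts on
  -- or below the critical line and ends on or above it, so its slope is at least `-1`.
  have hge : ∀ t ∈ Ioo x (xCrit Z), -1 ≤ slope s x t := fun t ht => by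
    refine le_trans ?_ (hconc.antitoneOn_slope_gt hxS (hsub ht) ⟨hxcS, hx.2⟩ ht.2.le)
    rw [slope_def_field, le_div_iff₀ (sub_pos.2 hx.2)]
    have h1 := hZ.le_outerBoundary₁ hZ.xCrit_mem
    have h2 := hZ.add_le_criticalPrice (hZ.outerBoundary₁_mem hxS)
    simp only [← hs] at h1 h2
    linarith
  have hbdd : BddBelow ((fun t => -slope s x t) '' Ioo x (xCrit Z)) :=
    ⟨0, by rintro _ ⟨t, ht, rfl⟩; exact neg_nonneg.2 (hle0 t ht)⟩
  have hlim0 := MonotoneOn.tendsto_nhdsWithin_Ioo_right (nonempty_Ioo.2 hx.2)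
    (fun a ha b hb hab => neg_le_neg (hanti ha hb hab) :
      MonotoneOn (fun t => -slope s x t) (Ioo x (xCrit Z))) hbdd
  obtain ⟨d, hlim⟩ : ∃ d, Tendsto (slope s x) (𝓝[>] x) (𝓝 d) := ⟨_, by simpa using hlim0.neg⟩
  have hev : ∀ᶠ t in 𝓝[>] x, t ∈ Ioo x (xCrit Z) := Ioo_mem_nhdsGT hx.2
  refine ⟨d, ⟨ge_of_tendsto hlim (hev.mono hge), le_of_tendsto hlim (hev.mono hle0)⟩, ?_, ?_⟩
  · rw [← hasDerivWithinAt_Ioi_iff_Ici, hasDerivWithinAt_iff_tendsto_slope' self_notMem_Ioi]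
    exact hlim
  · intro z hz
    have hzS : z.1 ∈ Prod.fst '' Z := mem_image_of_mem _ hz
    refine (hZ.le_outerBoundary₁ hz).trans ?_
    rw [← hs]
    -- Concavity compares the limit slope `d` with the chord from `x` to `z.1`: chords to the left
    -- have slope at least `d`, chords to the right at most `d`.
    rcases lt_trichotomy z.1 x with h | h | h
    · have : d ≤ (s x - s z.1) / (x - z.1) := by
        refine le_of_tendsto hlim (hev.mono fun t ht => ?_)
        rw [slope_def_field]
        exact hconc.slope_anti_adjacent hzS (hmem t ht) h ht.1
      rw [le_div_iff₀ (sub_pos.2 h)] at this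
      linarith
    · rw [h]; simp
    · have : slope s x z.1 ≤ d := by
        have hev' : ∀ᶠ t in 𝓝[>] x, t ∈ Ioo x z.1 := Ioo_mem_nhdsGT h
        refine ge_of_tendsto hlim ((hev.and hev').mono fun t ht => ?_)
        exact hconc.antitoneOn_slope_gt hxS (hsub ht.1) ⟨hzS, h⟩ ht.2.2.le
      rw [slope_def_field, div_le_iff₀ (sub_pos.2 h)] at this
      linarith

/-- Monotonicity suffices here, by Lebesgue's theorem on monotone functions. -/
theorem ae_differentiableAt_outerBoundary₁ (hZ : IsExclusionSet lo hi Z) :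
    ∀ᵐ x : ℝ, x ∈ Ioo lo.1 (xCrit Z) → DifferentiableAt ℝ (outerBoundary₁ Z) x := by
  have hm : MonotoneOn (fun x => -outerBoundary₁ Z x) (Ioo lo.1 (xCrit Z)) :=
    fun a ha b hb hab => neg_le_neg (hZ.antitoneOn_outerBoundary₁
      (hZ.mem_of_le_xCrit (Ioo_subset_Icc_self ha)) (hZ.mem_of_le_xCrit (Ioo_subset_Icc_self hb))
      hab)
  filter_upwards [hm.ae_differentiableWithinAt_of_mem] with x hx hxm
  simpa using ((hx hxm).differentiableAt (Ioo_mem_nhds hxm.1 hxm.2)).neg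

/-! #### The utility function -/

theorem exclusionUtility_le {z p : ℝ × ℝ} (hz : z ∈ Z) : exclusionUtility Z p ≤ l1dist z p :=
  csInf_le ⟨0, by rintro _ ⟨w, -, rfl⟩; exact add_nonneg (abs_nonneg _) (abs_nonneg _)⟩
    (mem_image_of_mem _ hz)

theorem le_exclusionUtility (hZ : IsExclusionSet lo hi Z) {c : ℝ} {p : ℝ × ℝ}
    (h : ∀ z ∈ Z, c ≤ l1dist z p) : c ≤ exclusionUtility Z p :=
  le_csInf (hZ.nonempty.image _) (by rintro _ ⟨z, hz, rfl⟩; exact h z hz)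

theorem exclusionUtility_nonneg (hZ : IsExclusionSet lo hi Z) (p : ℝ × ℝ) :
    0 ≤ exclusionUtility Z p :=
  hZ.le_exclusionUtility fun _ _ => add_nonneg (abs_nonneg _) (abs_nonneg _)

theorem exclusionUtility_of_mem (hZ : IsExclusionSet lo hi Z) {p : ℝ × ℝ} (hp : p ∈ Z) :
    exclusionUtility Z p = 0 :=
  le_antisymm (by simpa [l1dist] using exclusionUtility_le (p := p) hp)
    (hZ.exclusionUtility_nonneg p)

theorem exclusionUtility_swap (p : ℝ × ℝ) :
    exclusionUtility (Prod.swap ⁻¹' Z) p.swap = exclusionUtility Z p := by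
  unfold exclusionUtility
  congr 1
  ext t
  constructor
  · rintro ⟨z, hz, rfl⟩; exact ⟨z.swap, hz, add_comm _ _⟩
  · rintro ⟨z, hz, rfl⟩; exact ⟨z.swap, by rwa [mem_preimage, Prod.swap_swap], add_comm _ _⟩

/-- Buying the bundle at the critical price never gives more than `u_Z`. -/
theorem bundle_le_exclusionUtility (hZ : IsExclusionSet lo hi Z) (p : ℝ × ℝ) :
    p.1 + p.2 - criticalPrice Z ≤ exclusionUtility Z p := by
  refine hZ.le_exclusionUtility fun z hz => ?_
  have h1 := neg_abs_le (z.1 - p.1)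
  have h2 := neg_abs_le (z.2 - p.2)
  have h3 := hZ.add_le_criticalPrice hz
  rw [l1dist]
  linarith

/-- The left side is the payoff of a menu entry for `𝒜`. It is nonpositive on `Z`, since the tangent
line lies above `Z`, and its slopes `-d` and `1` lie in `[0,1]`. It therefore cannot exceed the `ℓ₁`
distance to any point of `Z`. -/
theorem tangent_le_exclusionUtility (hZ : IsExclusionSet lo hi Z) {x d : ℝ}
    (hd : -1 ≤ d ∧ d ≤ 0) (ht : ∀ z ∈ Z, z.2 ≤ outerBoundary₁ Z x + d * (z.1 - x)) (p : ℝ × ℝ) :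
    p.1 * -d + p.2 - (outerBoundary₁ Z x - x * d) ≤ exclusionUtility Z p := by
  refine hZ.le_exclusionUtility fun z hz => ?_
  have h1 : (p.1 - z.1) * -d ≤ |z.1 - p.1| := by
    rw [abs_sub_comm]
    refine (mul_le_mul_of_nonneg_right (le_abs_self _) (by linarith)).trans ?_
    exact mul_le_of_le_one_right (abs_nonneg _) (by linarith)
  have h2 := neg_abs_le (z.2 - p.2)
  have h3 := ht z hz
  rw [l1dist]
  linarith

/-- The point of `Z` vertically below `p` gives the upper bound, and the tangent at that point the
lower one. -/
theorem exclusionUtility_of_mem_regionA (hZ : IsExclusionSet lo hi Z) {p : ℝ × ℝ}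
    (hp : p ∈ regionA (Icc lo hi) Z) : exclusionUtility Z p = p.2 - outerBoundary₁ Z p.1 := by
  obtain ⟨⟨hX, hx⟩, hpZ⟩ := hp
  have hxS := hZ.mem_of_le_xCrit ⟨hX.1.1, hx.le⟩
  have hmem := hZ.outerBoundary₁_mem hxS
  obtain ⟨d, hd, -, ht⟩ := hZ.exists_rightDeriv ⟨hX.1.1, hx⟩
  refine le_antisymm ((exclusionUtility_le hmem).trans ?_) ?_
  · have : outerBoundary₁ Z p.1 ≤ p.2 := by
      by_contra h
      exact hpZ (hZ.decreasing p hX _ hmem ⟨le_rfl, (not_le.1 h).le⟩)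
    rw [l1dist, sub_self, abs_zero, zero_add, abs_of_nonpos (sub_nonpos.2 this), neg_sub]
  · have := hZ.tangent_le_exclusionUtility hd ht p
    linarith

theorem swap_mem_regionA_iff {p : ℝ × ℝ} :
    p.swap ∈ regionA (Icc lo.swap hi.swap) (Prod.swap ⁻¹' Z) ↔ p ∈ regionB (Icc lo hi) Z := by
  simp only [regionA, regionB, Set.mem_sdiff, mem_ofPred_eq, swap_mem_box_iff, xCrit_swap,
    Prod.fst_swap, mem_preimage, Prod.swap_swap]

theorem exclusionUtility_of_mem_regionB (hZ : IsExclusionSet lo hi Z) {p : ℝ × ℝ}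
    (hp : p ∈ regionB (Icc lo hi) Z) : exclusionUtility Z p = p.1 - outerBoundary₂ Z p.2 := by
  rw [← exclusionUtility_swap]
  exact hZ.swap.exclusionUtility_of_mem_regionA (swap_mem_regionA_iff.2 hp)

theorem le_of_mem_regionW {p : ℝ × ℝ} (hp : p ∈ regionW (Icc lo hi) Z) :
    p ∈ Icc lo hi ∧ xCrit Z ≤ p.1 ∧ yCrit Z ≤ p.2 ∧ p ∉ Z := by
  obtain ⟨hX, hn⟩ := hp
  simp only [regionA, regionB, mem_union, Set.mem_sdiff, mem_ofPred_eq, not_or, not_and, not_not] at hn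
  obtain ⟨⟨hZ, hA⟩, hB⟩ := hn
  exact ⟨hX, not_lt.1 fun h => hZ (hA ⟨hX, h⟩), not_lt.1 fun h => hZ (hB ⟨hX, h⟩), hZ⟩

/-- A point of `Z` below `p` at the critical price gives the upper bound; the bundle payoff gives
the lower one. -/
theorem exclusionUtility_of_mem_regionW (hZ : IsExclusionSet lo hi Z) {p : ℝ × ℝ}
    (hp : p ∈ regionW (Icc lo hi) Z) : exclusionUtility Z p = p.1 + p.2 - criticalPrice Z := by
  obtain ⟨hX, h1, h2, hpZ⟩ := le_of_mem_regionW hp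
  obtain ⟨z, hz, hzp, hzP⟩ := hZ.exists_le_of_mem_regionW hX h1 h2 hpZ
  refine le_antisymm ((exclusionUtility_le hz).trans ?_) (hZ.bundle_le_exclusionUtility p)
  rw [l1dist, abs_of_nonpos (sub_nonpos.2 hzp.1), abs_of_nonpos (sub_nonpos.2 hzp.2), ← hzP]
  linarith

theorem disjoint_regionA_regionB (hZ : IsExclusionSet lo hi Z) :
    Disjoint (regionA (Icc lo hi) Z) (regionB (Icc lo hi) Z) :=
  disjoint_left.2 fun _ hA hB => hA.2 (hZ.mem_of_lt_crit hA.1.1 hA.1.2.le hB.1.2.le)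

theorem mem_cases {p : ℝ × ℝ} (hp : p ∈ Icc lo hi) :
    p ∈ Z ∨ p ∈ regionA (Icc lo hi) Z ∨ p ∈ regionB (Icc lo hi) Z ∨ p ∈ regionW (Icc lo hi) Z := by
  by_cases h : p ∈ Z ∪ regionA (Icc lo hi) Z ∪ regionB (Icc lo hi) Z
  · rcases h with (h | h) | h
    · exact Or.inl h
    · exact Or.inr (Or.inl h)
    · exact Or.inr (Or.inr (Or.inl h))
  · exact Or.inr (Or.inr (Or.inr ⟨hp, h⟩))

end IsExclusionSet

/-! ### The canonical mechanism -/

/-- No misreport yields more than `u_Z`, and truth-telling yields exactly `u_Z`, so incentive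
compatibility is immediate. Only the geometry of `Z` enters; the density plays no role. -/
theorem exists_canonicalMechanism {lo hi : ℝ × ℝ} {Z : Set (ℝ × ℝ)}
    (hZ : IsExclusionSet lo hi Z) :
    ∃ (M : Mechanism (Icc lo hi)) (d₁ d₂ : ℝ → ℝ), M.IsIC ∧
      (∀ p ∈ Icc lo hi, M.utility p = exclusionUtility Z p) ∧
      (∀ x ∈ Ico lo.1 (xCrit Z), HasDerivWithinAt (outerBoundary₁ Z) (d₁ x) (Ici x) x) ∧
      (∀ y ∈ Ico lo.2 (yCrit Z), HasDerivWithinAt (outerBoundary₂ Z) (d₂ y) (Ici y) y) ∧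
      ∀ p ∈ Icc lo hi, HasCanonicalOutcome M Z d₁ d₂ p := by
  classical
  have h₁ : ∀ x : ℝ, x ∈ Ico lo.1 (xCrit Z) → ∃ d, (-1 ≤ d ∧ d ≤ 0) ∧
      HasDerivWithinAt (outerBoundary₁ Z) d (Ici x) x ∧
      ∀ z ∈ Z, z.2 ≤ outerBoundary₁ Z x + d * (z.1 - x) := fun x hx => hZ.exists_rightDeriv hx
  have h₂ : ∀ y : ℝ, y ∈ Ico lo.2 (yCrit Z) → ∃ d, (-1 ≤ d ∧ d ≤ 0) ∧
      HasDerivWithinAt (outerBoundary₂ Z) d (Ici y) y ∧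
      ∀ z ∈ Prod.swap ⁻¹' Z, z.2 ≤ outerBoundary₂ Z y + d * (z.1 - y) := fun y hy =>
    hZ.swap.exists_rightDeriv (by rwa [IsExclusionSet.xCrit_swap])
  choose! d₁ hd₁ hder₁ ht₁ using h₁
  choose! d₂ hd₂ hder₂ ht₂ using h₂
  let M : Mechanism (Icc lo hi) :=
    { alloc := fun p => if p ∈ Z then (0, 0) else if p.1 < xCrit Z then (-d₁ p.1, 1) else
        if p.2 < yCrit Z then (1, -d₂ p.2) else (1, 1)
      price := fun p => if p ∈ Z then 0 else
        if p.1 < xCrit Z then outerBoundary₁ Z p.1 - p.1 * d₁ p.1 else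
        if p.2 < yCrit Z then outerBoundary₂ Z p.2 - p.2 * d₂ p.2 else criticalPrice Z
      alloc_mem := fun p hp => by
        split_ifs with h1 h2 h3
        · exact ⟨⟨le_rfl, le_rfl⟩, zero_le_one, zero_le_one⟩
        · have := hd₁ _ ⟨hp.1.1, h2⟩
          exact ⟨⟨neg_nonneg.2 this.2, zero_le_one⟩, neg_le.1 this.1, le_rfl⟩
        · have := hd₂ _ ⟨hp.1.2, h3⟩
          exact ⟨⟨zero_le_one, neg_nonneg.2 this.2⟩, le_rfl, neg_le.1 this.1⟩
        · exact ⟨⟨zero_le_one, zero_le_one⟩, le_rfl, le_rfl⟩ }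
  have hout : ∀ p ∈ Icc lo hi, HasCanonicalOutcome M Z d₁ d₂ p := by
    intro p hp
    refine ⟨fun h => ?_, fun h => ?_, fun h => ?_, fun h => ?_⟩
    · simp [M, h]
    · have h1 : p ∉ Z := h.2
      have h2 : p.1 < xCrit Z := h.1.2
      simp [M, h1, h2]
    · have h1 : p ∉ Z := h.2
      -- The definition tests for `𝒜` before `ℬ`; disjointness of the two regions makes the order
      -- harmless.
      have h2 : ¬ p.1 < xCrit Z := fun h' =>
        disjoint_left.1 hZ.disjoint_regionA_regionB ⟨⟨hp, h'⟩, h1⟩ h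
      have h3 : p.2 < yCrit Z := h.1.2
      simp only [M, if_neg h1, if_neg h2, if_pos h3, and_self]
    · obtain ⟨-, h2, h3, h1⟩ := IsExclusionSet.le_of_mem_regionW h
      simp only [M, if_neg h1, if_neg h2.not_gt, if_neg h3.not_gt, and_self]
  have hle : ∀ p, ∀ q ∈ Icc lo hi, M.payoff p q ≤ exclusionUtility Z p := by
    intro p q hq
    have ho := hout q hq
    rw [Mechanism.payoff]
    rcases IsExclusionSet.mem_cases (Z := Z) hq with h | h | h | h
    · rw [(ho.on_Z h).1, (ho.on_Z h).2]
      simpa using hZ.exclusionUtility_nonneg p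
    · rw [(ho.on_A h).1, (ho.on_A h).2, mul_one]
      have hx : q.1 ∈ Ico lo.1 (xCrit Z) := ⟨hq.1.1, h.1.2⟩
      exact hZ.tangent_le_exclusionUtility (hd₁ _ hx) (ht₁ _ hx) p
    · rw [(ho.on_B h).1, (ho.on_B h).2, mul_one, ← IsExclusionSet.exclusionUtility_swap p]
      have hy : q.2 ∈ Ico lo.2 (yCrit Z) := ⟨hq.1.2, h.1.2⟩
      have := hZ.swap.tangent_le_exclusionUtility (hd₂ _ hy) (ht₂ _ hy) p.swap
      rw [Prod.fst_swap, Prod.snd_swap] at this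
      rw [add_comm p.1]
      exact this
    · rw [(ho.on_W h).1, (ho.on_W h).2, mul_one, mul_one]
      exact hZ.bundle_le_exclusionUtility p
  have hu : ∀ p ∈ Icc lo hi, M.utility p = exclusionUtility Z p := by
    intro p hp
    have ho := hout p hp
    rw [Mechanism.utility, Mechanism.payoff]
    rcases IsExclusionSet.mem_cases (Z := Z) hp with h | h | h | h
    · rw [(ho.on_Z h).1, (ho.on_Z h).2, hZ.exclusionUtility_of_mem h]
      simp
    · rw [(ho.on_A h).1, (ho.on_A h).2, hZ.exclusionUtility_of_mem_regionA h]
      ring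
    · rw [(ho.on_B h).1, (ho.on_B h).2, hZ.exclusionUtility_of_mem_regionB h]
      ring
    · rw [(ho.on_W h).1, (ho.on_W h).2, hZ.exclusionUtility_of_mem_regionW h]
      ring
  exact ⟨M, d₁, d₂, fun p hp q hq => (hle p q hq).trans_eq (hu p hp).symm, hu, hder₁, hder₂, hout⟩

/-! ### Optimality -/

/-- The counterpart of `integral_nonneg_of_strips` for horizontal strips. -/
theorem integral_nonneg_of_strips_snd {lo hi : ℝ × ℝ} (hlh : lo ≤ hi) {ν : SignedMeasure (ℝ × ℝ)}
    (hν : ν.variation (Icc lo hi)ᶜ = 0)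
    (hstrip : ∀ v ∈ Icc lo hi, ∀ ε : ℝ, 0 < ε →
      0 ≤ ν (Ici v.1 ×ˢ Icc v.2 (v.2 + ε)) ∧
      (v.1 = lo.1 → ν (Ici v.1 ×ˢ Icc v.2 (v.2 + ε)) = 0))
    {ψ : ℝ × ℝ → ℝ} (hc : ContinuousOn ψ (Icc lo hi))
    (hm : ∀ p ∈ Icc lo hi, ∀ q ∈ Icc lo hi, p.2 = q.2 → p.1 ≤ q.1 → ψ p ≤ ψ q) :
    0 ≤ ∫ᵛ p, ψ p ∂<•ν := by
  have hmem : ∀ p ∈ Icc lo.swap hi.swap, p.swap ∈ Icc lo hi := fun p hp => by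
    rwa [← swap_mem_box_iff, Prod.swap_swap]
  have hsw : MeasurableEmbedding (Prod.swap : ℝ × ℝ → ℝ × ℝ) :=
    (MeasurableEquiv.prodComm (α := ℝ) (β := ℝ)).measurableEmbedding
  have hmap : ∀ a b : Set ℝ, MeasurableSet a → MeasurableSet b →
      ν.map Prod.swap (a ×ˢ b) = ν (b ×ˢ a) := fun a b ha hb => by
    rw [VectorMeasure.map_apply _ hsw.measurable (ha.prod hb), preimage_swap_prod]
  have h := integral_nonneg_of_strips (lo := lo.swap) (hi := hi.swap) (Prod.swap_le_swap.2 hlh)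
    (ν := ν.map Prod.swap) (ψ := fun p => ψ p.swap) ?_ ?_
    (hc.comp continuous_swap.continuousOn hmem)
    (fun p hp q hq h1 h2 => hm _ (hmem p hp) _ (hmem q hq) h1 h2)
  · rw [hsw.integral_map_vectorMeasure] at h
    simpa only [Prod.swap_swap] using h
  · rw [hsw.variation_map, Measure.map_apply hsw.measurable measurableSet_Icc.compl]
    convert hν using 2
    ext p
    simp only [mem_preimage, mem_compl_iff, swap_mem_box_iff]
  · intro v hv ε hε
    rw [hmap _ _ measurableSet_Icc measurableSet_Ici]
    exact hstrip _ (hmem v hv) ε hε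

namespace IsExclusionSet

variable {lo hi : ℝ × ℝ} {Z : Set (ℝ × ℝ)}

/-- `u_Z` is the utility of an IC mechanism, and such utilities are Lipschitz. -/
theorem continuousOn_exclusionUtility (hZ : IsExclusionSet lo hi Z) :
    ContinuousOn (exclusionUtility Z) (Icc lo hi) := by
  obtain ⟨M, -, -, hM, hu, -⟩ := exists_canonicalMechanism hZ
  exact hM.continuousOn_utility.congr fun p hp => (hu p hp).symm

theorem measurableSet_regionA (hZ : IsExclusionSet lo hi Z) :
    MeasurableSet (regionA (Icc lo hi) Z) :=
  (measurableSet_Icc.inter (measurableSet_lt measurable_fst measurable_const)).diff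
    hZ.isCompact.measurableSet

theorem measurableSet_regionB (hZ : IsExclusionSet lo hi Z) :
    MeasurableSet (regionB (Icc lo hi) Z) :=
  (measurableSet_Icc.inter (measurableSet_lt measurable_snd measurable_const)).diff
    hZ.isCompact.measurableSet

theorem measurableSet_regionW (hZ : IsExclusionSet lo hi Z) :
    MeasurableSet (regionW (Icc lo hi) Z) :=
  measurableSet_Icc.diff ((hZ.isCompact.measurableSet.union hZ.measurableSet_regionA).union
    hZ.measurableSet_regionB)

theorem integral_eq_sum_regions (hZ : IsExclusionSet lo hi Z) {μ : SignedMeasure (ℝ × ℝ)}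
    (hμ : μ.variation (Icc lo hi)ᶜ = 0) {g : ℝ × ℝ → ℝ} (hg : ContinuousOn g (Icc lo hi)) :
    ∫ᵛ p, g p ∂<•μ = ∫ᵛ p in Z, g p ∂<•μ + ∫ᵛ p in regionA (Icc lo hi) Z, g p ∂<•μ
      + ∫ᵛ p in regionB (Icc lo hi) Z, g p ∂<•μ + ∫ᵛ p in regionW (Icc lo hi) Z, g p ∂<•μ := by
  have hint : μ.Integrable g := integrable_of_continuousOn isCompact_Icc hμ hg
  have hi' : ∀ s, μ.IntegrableOn g s := fun s => hint.restrict
  have mZ := hZ.isCompact.measurableSet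
  have mA := hZ.measurableSet_regionA
  have mB := hZ.measurableSet_regionB
  have mW := hZ.measurableSet_regionW
  rw [← VectorMeasure.setIntegral_add_compl measurableSet_Icc hint,
    VectorMeasure.setIntegral_of_variation_apply_eq_zero g hμ, add_zero,
    ← VectorMeasure.setIntegral_union (disjoint_left.2 fun p h1 h2 => h2.2 h1) mZ mA (hi' _) (hi' _),
    ← VectorMeasure.setIntegral_union
      (disjoint_union_left.2 ⟨disjoint_left.2 fun p h1 h2 => h2.2 h1, hZ.disjoint_regionA_regionB⟩)
      (mZ.union mA) mB (hi' _) (hi' _),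
    ← VectorMeasure.setIntegral_union (disjoint_left.2 fun p h1 h2 => h2.2 h1)
      ((mZ.union mA).union mB) mW (hi' _) (hi' _)]
  have : Icc lo hi = Z ∪ regionA (Icc lo hi) Z ∪ regionB (Icc lo hi) Z ∪ regionW (Icc lo hi) Z := by
    refine Subset.antisymm (fun p hp => ?_) ?_
    · rcases mem_cases (Z := Z) hp with h | h | h | h
      · exact Or.inl (Or.inl (Or.inl h))
      · exact Or.inl (Or.inl (Or.inr h))
      · exact Or.inl (Or.inr h)
      · exact Or.inr h
    · exact union_subset (union_subset (union_subset hZ.subset fun p h => h.1.1)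
        fun p h => h.1.1) fun p h => h.1
  rw [← this]

end IsExclusionSet

/-- If the canonical partition is well-formed, then `u_Z` has the largest integral among all
continuous, non-decreasing, convex functions whose increments are bounded by the `ℓ₁` distance. -/
theorem integral_le_integral_exclusionUtility {lo hi : ℝ × ℝ} {Z : Set (ℝ × ℝ)}
    (hZ : IsExclusionSet lo hi Z) {μ : SignedMeasure (ℝ × ℝ)}
    (hμ : μ.variation (Icc lo hi)ᶜ = 0) (hwf : WellFormed lo hi Z μ) {v : ℝ × ℝ → ℝ}
    (hc : ContinuousOn v (Icc lo hi)) (hmono : MonotoneOn v (Icc lo hi))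
    (hconv : ConvexOn ℝ (Icc lo hi) v)
    (hlip : ∀ p ∈ Icc lo hi, ∀ q ∈ Icc lo hi, p ≤ q →
      v q - v p ≤ (q.1 - p.1) + (q.2 - p.2)) :
    ∫ᵛ p, v p ∂<•μ ≤ ∫ᵛ p, exclusionUtility Z p ∂<•μ := by
  have hle := hZ.le
  have hu := hZ.continuousOn_exclusionUtility
  have hvar : ∀ s, (μ.restrict s).variation (Icc lo hi)ᶜ = 0 := fun s =>
    le_antisymm ((VectorMeasure.variation_restrict_le _).trans
      ((Measure.restrict_apply_le _ _).trans hμ.le)) zero_le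
  have hgc : ContinuousOn (fun p => exclusionUtility Z p - v p) (Icc lo hi) := hu.sub hc
  rw [← sub_nonneg, ← VectorMeasure.integral_fun_sub (integrable_of_continuousOn isCompact_Icc hμ hu)
    (integrable_of_continuousOn isCompact_Icc hμ hc), hZ.integral_eq_sum_regions hμ hgc]
  have hIZ : 0 ≤ ∫ᵛ p in Z, (exclusionUtility Z p - v p) ∂<•μ := by
    have h := hwf.dom_Z v hc hmono hconv
    rw [VectorMeasure.integral_zero_vectorMeasure] at h
    rw [VectorMeasure.setIntegral_congr_fun (g := fun p => -v p) fun p hp => by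
      simp only [hZ.exclusionUtility_of_mem hp, zero_sub], VectorMeasure.integral_fun_neg]
    exact neg_nonneg.2 h
  -- Subtracting the affine function `x + y - P` preserves convexity, and the increment bound on `v`
  -- makes the difference non-increasing on the whole box, as the dominance condition requires.
  have hIW : 0 ≤ ∫ᵛ p in regionW (Icc lo hi) Z, (exclusionUtility Z p - v p) ∂<•μ := by
    have h := hwf.dom_W (fun p => v p - (p.1 + p.2 - criticalPrice Z)) (hc.sub (by fun_prop))
      (fun p hp q hq hpq => by have := hlip p hp q hq hpq; simp only; linarith)
      (by
        refine hconv.sub ⟨convex_Icc lo hi, fun p _ q _ a b _ _ hab => le_of_eq ?_⟩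
        simp only [Prod.fst_add, Prod.snd_add, Prod.smul_fst, Prod.smul_snd, smul_eq_mul]
        linear_combination (-criticalPrice Z) * hab)
    rw [VectorMeasure.integral_zero_vectorMeasure] at h
    rw [VectorMeasure.setIntegral_congr_fun
      (g := fun p => -(v p - (p.1 + p.2 - criticalPrice Z))) fun p hp => by
      simp only [hZ.exclusionUtility_of_mem_regionW hp, neg_sub], VectorMeasure.integral_fun_neg]
    exact neg_nonneg.2 h
  have hIA : 0 ≤ ∫ᵛ p in regionA (Icc lo hi) Z, (exclusionUtility Z p - v p) ∂<•μ := by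
    have hmem : ∀ p ∈ Icc lo hi, (p.1, hi.2) ∈ Icc lo hi := fun p hp =>
      ⟨⟨hp.1.1, hle.2⟩, hp.2.1, le_rfl⟩
    -- Monotonicity in `p.2` is needed on the whole box, but `u_Z = y - s₁(x)` only on `𝒜`. Reading
    -- `-s₁` off the top edge, where `(p.1, hi.2)` stays in `𝒜` if `p` does, gives a continuous
    -- integrand on the box that agrees with the original on `𝒜` and is non-decreasing in `p.2`
    -- everywhere.
    rw [VectorMeasure.setIntegral_congr_fun
      (g := fun p => exclusionUtility Z (p.1, hi.2) - hi.2 + p.2 - v p) fun p hp => ?_]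
    · refine integral_nonneg_of_strips hle (hvar _) hwf.strip_A
        ((((hu.comp (by fun_prop) hmem).sub continuousOn_const).add (by fun_prop)).sub hc)
        fun p hp q hq h1 h2 => ?_
      have := hlip p hp q hq ⟨h1.le, h2⟩
      simp only [h1] at this ⊢
      linarith
    · have hq : (p.1, hi.2) ∈ regionA (Icc lo hi) Z :=
        ⟨⟨hmem p hp.1.1, hp.1.2⟩, fun h => hp.2 (hZ.decreasing p hp.1.1 _ h ⟨le_rfl, hp.1.1.2.2⟩)⟩
      simp only [hZ.exclusionUtility_of_mem_regionA hp, hZ.exclusionUtility_of_mem_regionA hq]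
      ring
  have hIB : 0 ≤ ∫ᵛ p in regionB (Icc lo hi) Z, (exclusionUtility Z p - v p) ∂<•μ := by
    have hmem : ∀ p ∈ Icc lo hi, (hi.1, p.2) ∈ Icc lo hi := fun p hp =>
      ⟨⟨hle.1, hp.1.2⟩, le_rfl, hp.2.2⟩
    rw [VectorMeasure.setIntegral_congr_fun
      (g := fun p => exclusionUtility Z (hi.1, p.2) - hi.1 + p.1 - v p) fun p hp => ?_]
    · refine integral_nonneg_of_strips_snd hle (hvar _) hwf.strip_B
        ((((hu.comp (by fun_prop) hmem).sub continuousOn_const).add (by fun_prop)).sub hc)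
        fun p hp q hq h1 h2 => ?_
      have := hlip p hp q hq ⟨h2, h1.le⟩
      simp only [h1] at this ⊢
      linarith
    · have hq : (hi.1, p.2) ∈ regionB (Icc lo hi) Z :=
        ⟨⟨hmem p hp.1.1, hp.1.2⟩, fun h => hp.2 (hZ.decreasing p hp.1.1 _ h ⟨hp.1.1.2.1, le_rfl⟩)⟩
      simp only [hZ.exclusionUtility_of_mem_regionB hp, hZ.exclusionUtility_of_mem_regionB hq]
      ring
  exact add_nonneg (add_nonneg (add_nonneg hIZ hIA) hIB) hIW

/-- Every incentive compatible mechanism with utility `u_Z` is optimal. -/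
theorem isOptimal_of_utility_eq {lo hi : ℝ × ℝ} {f : ℝ × ℝ → ℝ} (hf : IsTypeDensity lo hi f)
    {Z : Set (ℝ × ℝ)} (hZ : IsExclusionSet lo hi Z)
    (hwf : WellFormed lo hi Z (transformedMeasure lo hi f)) {M : Mechanism (Icc lo hi)}
    (hM : M.IsIC) (hu : ∀ p ∈ Icc lo hi, M.utility p = exclusionUtility Z p) : M.IsOptimal f := by
  have hμ := hf.variation_transformedMeasure_compl
  refine ⟨hM, fun p hp => (hu p hp).symm ▸ hZ.exclusionUtility_nonneg p, (revenue_eq hf hM).1,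
    fun M' hM' hIR => ⟨(revenue_eq hf hM').1, ?_⟩⟩
  have hlo : lo ∈ Icc lo hi := ⟨le_rfl, hZ.le⟩
  have hcongr : ∫ᵛ p, M.utility p ∂<•(transformedMeasure lo hi f) =
      ∫ᵛ p, exclusionUtility Z p ∂<•(transformedMeasure lo hi f) := by
    refine VectorMeasure.integral_congr_ae ?_
    have : ∀ᵐ p ∂(transformedMeasure lo hi f).variation, p ∈ Icc lo hi := hμ
    exact this.mono hu
  -- The canonical utility vanishes at `lo`, while that of the competitor is nonnegative there, so
  -- the subtracted terms only help.
  rw [(revenue_eq hf hM').2, (revenue_eq hf hM).2, hcongr, hu lo hlo,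
    hZ.exclusionUtility_of_mem hZ.lo_mem, sub_zero]
  have h1 := hIR lo hlo
  have h2 := integral_le_integral_exclusionUtility hZ hμ hwf hM'.continuousOn_utility
    hM'.monotoneOn_utility hM'.convexOn_utility fun p hp q hq hpq => hM'.utility_sub_le hp hq hpq
  linarith

/-! ### Almost everywhere uniqueness and the main theorem -/

theorem ae_fst {P : ℝ → Prop} (h : ∀ᵐ x : ℝ, P x) : ∀ᵐ p : ℝ × ℝ, P p.1 := by
  rw [Measure.volume_eq_prod]
  exact Measure.quasiMeasurePreserving_fst.ae h

theorem ae_snd {P : ℝ → Prop} (h : ∀ᵐ x : ℝ, P x) : ∀ᵐ p : ℝ × ℝ, P p.2 := by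
  rw [Measure.volume_eq_prod]
  exact Measure.quasiMeasurePreserving_snd.ae h

end TwoGoods

/-- If the canonical partition induced by an exclusion set `Z` is well-formed with respect to the
transformed measure of `f`, then (first part) there is an optimal IC and IR mechanism with utility
function `u_Z` that uses the canonical outcome at every type, the derivatives of the boundary
functions being right derivatives (which are the derivatives wherever these exist), and (second
part) every IC mechanism with utility function `u_Z` is optimal, and at almost every type it uses
the canonical outcome with genuine derivatives of the boundary functions. -/
theorem theorem8 (lo hi : ℝ × ℝ) (hlo : 0 ≤ lo) (f : ℝ × ℝ → ℝ) (hf : IsTypeDensity lo hi f)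
    (Z : Set (ℝ × ℝ)) (hZ : IsExclusionSet lo hi Z)
    (hwf : WellFormed lo hi Z (transformedMeasure lo hi f)) :
    (∃ (M : Mechanism (Icc lo hi)) (d₁ d₂ : ℝ → ℝ),
        M.IsOptimal f ∧
        (∀ p ∈ Icc lo hi, M.utility p = exclusionUtility Z p) ∧
        (∀ x ∈ Ico lo.1 (xCrit Z), HasDerivWithinAt (outerBoundary₁ Z) (d₁ x) (Ici x) x) ∧
        (∀ y ∈ Ico lo.2 (yCrit Z), HasDerivWithinAt (outerBoundary₂ Z) (d₂ y) (Ici y) y) ∧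
        ∀ p ∈ Icc lo hi, HasCanonicalOutcome M Z d₁ d₂ p) ∧
    (∀ M : Mechanism (Icc lo hi), M.IsIC →
        (∀ p ∈ Icc lo hi, M.utility p = exclusionUtility Z p) →
        M.IsOptimal f ∧
        ∀ᵐ p ∂(volume.restrict (Icc lo hi)),
          (p ∈ regionA (Icc lo hi) Z → DifferentiableAt ℝ (outerBoundary₁ Z) p.1) ∧
          (p ∈ regionB (Icc lo hi) Z → DifferentiableAt ℝ (outerBoundary₂ Z) p.2) ∧
          HasCanonicalOutcome M Z (deriv (outerBoundary₁ Z)) (deriv (outerBoundary₂ Z)) p) := by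
  have hlt := hf.lt
  obtain ⟨M₀, d₁, d₂, hM₀, hu₀, hder₁, hder₂, hout⟩ := exists_canonicalMechanism hZ
  refine ⟨⟨M₀, d₁, d₂, isOptimal_of_utility_eq hf hZ hwf hM₀ hu₀, hu₀, hder₁, hder₂, hout⟩,
    fun M hM hu => ⟨isOptimal_of_utility_eq hf hZ hwf hM hu, ?_⟩⟩
  have hle := hZ.le
  have hext : M.extendedUtility = M₀.extendedUtility := by
    funext p
    rw [Mechanism.extendedUtility, Mechanism.extendedUtility, hu _ (clamp_mem hle p),
      hu₀ _ (clamp_mem hle p)]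
  have hae₁ := ae_fst hZ.ae_differentiableAt_outerBoundary₁
  have hae₂ := ae_snd hZ.swap.ae_differentiableAt_outerBoundary₁
  filter_upwards [hM.ae_alloc_eq hle, hM₀.ae_alloc_eq hle, ae_mem_interior_box lo hi,
    ae_restrict_of_ae hae₁, ae_restrict_of_ae hae₂] with p ha ha₀ hp h₁ h₂
  have hpX := interior_subset hp
  rw [interior_box] at hp
  have halloc : M.alloc p = M₀.alloc p := by rw [ha, ha₀, hext]
  have hprice : M.price p = M₀.price p := by
    rw [M.price_eq, M₀.price_eq, halloc, hu p hpX, hu₀ p hpX]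
  have hdA : p ∈ regionA (Icc lo hi) Z → DifferentiableAt ℝ (outerBoundary₁ Z) p.1 := fun h =>
    h₁ ⟨hp.1.1, h.1.2⟩
  have hdB : p ∈ regionB (Icc lo hi) Z → DifferentiableAt ℝ (outerBoundary₂ Z) p.2 := fun h =>
    h₂ ⟨hp.2.1, by rw [IsExclusionSet.xCrit_swap]; exact h.1.2⟩
  -- Where the two-sided derivative exists it restricts to a right derivative, and right derivatives
  -- are unique.
  have hA : p ∈ regionA (Icc lo hi) Z → deriv (outerBoundary₁ Z) p.1 = d₁ p.1 := fun h =>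
    (uniqueDiffWithinAt_Ici p.1).eq_deriv _ (hdA h).hasDerivAt.hasDerivWithinAt
      (hder₁ _ ⟨hpX.1.1, h.1.2⟩)
  have hB : p ∈ regionB (Icc lo hi) Z → deriv (outerBoundary₂ Z) p.2 = d₂ p.2 := fun h =>
    (uniqueDiffWithinAt_Ici p.2).eq_deriv _ (hdB h).hasDerivAt.hasDerivWithinAt
      (hder₂ _ ⟨hpX.1.2, h.1.2⟩)
  have ho := hout p hpX
  refine ⟨hdA, hdB, ?_, ?_, ?_, ?_⟩
  · rw [halloc, hprice]; exact ho.on_Z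
  · intro h
    rw [halloc, hprice, hA h]
    exact ho.on_A h
  · intro h
    rw [halloc, hprice, hB h]
    exact ho.on_B h
  · rw [halloc, hprice]; exact ho.on_W
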